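/- Let $K=\mathbb R$ or $\mathbb C$ and let $(\mathcal G,\mu)$ be a finite-dimensional Lie algebra over $K$, with dual space $\mathcal G^*$. The pairing of $\Lambda\mathcal G^*$ and $\Lambda\mathcal G$ is $\langle\xi_1\wedge\dots\wedge\xi_m,x_1\wedge\dots\wedge x_n\rangle=\delta_{mn}\det(\langle\xi_i,x_j\rangle)$, and $i_A$ denotes the transpose of left exterior multiplication by $A$, so that $i_{\xi_1\wedge\dots\wedge\xi_m}=i_{\xi_m}\cdots i_{\xi_1}$. We regard $\Lambda^n\mathcal G\subset\mathcal G^{\otimes n}$ through $x_1\wedge\dots\wedge x_n=\sum_\sigma \mathrm{sign}(\sigma)\,x_{\sigma(1)}\otimes\dots\otimes x_{\sigma(n)}$ and put $\mathrm{Alt}(x_1\otimes\dots\otimes x_n)=\sum_\sigma \mathrm{sign}(\sigma)\,x_{\sigma(1)}\otimes\dots\otimes x_{\sigma(n)}$. Let $x\cdot$ denote the adjoint action of $x\in\mathcal G$ on tensors. Let $(\mathcal G,\mu,\gamma,\phi)$ be a Lie quasi-bialgebra, that is, $\gamma:\mathcal G\to\Lambda^2\mathcal G$ is linear, $\phi\in\Lambda^3\mathcal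 G$, and for all $x,y\in\mathcal G$ $$\gamma(\mu(x,y))=x\cdot\gamma(y)-y\cdot\gamma(x),\qquad \tfrac12\mathrm{Alt}(\gamma\otimes1)\gamma(x)=-\,x\cdot\phi,\qquad \mathrm{Alt}(\gamma\otimes1\otimes1)(\phi)=0 .$$ Define $\gamma(\xi,\eta)\in\mathcal G^*$, $ad^{\mu*}_x\xi\in\mathcal G^*$, $ad^{\gamma*}_\xi x\in\mathcal G$ and $\phi(\xi,\eta)\in\mathcal G$ by $\langle x,\gamma(\xi,\eta)\rangle=-\langle\gamma(x),\xi\wedge\eta\rangle$, $\langle ad^{\mu*}_x\xi,y\rangle=-\langle\xi,\mu(x,y)\rangle$, $\langle ad^{\gamma*}_\xi x,\eta\rangle=-\langle x,\gamma(\xi,\eta)\rangle$, $\phi(\xi,\eta)=i_{\xi\wedge\eta}\phi$. On $\mathcal D=\mathcal G\oplus\mathcal G^*$ take the antisymmetric bilinear bracket with $$[x,y]_{\mathcal D}=\mu(x,y),\quad [x,\xi]_{\mathcal D}=-ad^{\gamma*}_\xi x+ad^{\mu*}_x\xi,\quad [\xi,\eta]_{\mathcal D}=\phi(\xi,\eta)+\gamma(\xi,\eta).$$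 Let $\mathcal D$ act on $\Lambda\mathcal D$ by extending $ad_v=[v,\cdot]_{\mathcal D}$ to a derivation of the exterior algebra. Define $\Re:\mathcal D\to \mathrm{End}(\Lambda\mathcal G)$ linearly by $$\Re_x(Y)=\gamma(x)\wedge Y+ad^\mu_xY-\tfrac12\mathrm{tr}(ad^\mu_x)\,Y,\qquad \Re_\xi(Y)=-i_{d_\mu\xi}Y+ad^{\gamma*}_\xi Y-(i_\xi\phi)\wedge Y+\tfrac12\mathrm{tr}(ad^\gamma_\xi)\,Y,$$ where $ad^\mu_x=\mu(x,\cdot)$ and $ad^{\gamma*}_\xi$ are extended to $\Lambda\mathcal G$ as derivations, $ad^\gamma_\xi=\gamma(\xi,\cdot)\in\mathrm{End}(\mathcal G^*)$, and $d_\mu\xi\in\Lambda^2\mathcal G^*$ satisfies $\langle d_\mu\xi,x\wedge y\rangle=-\langle\xi,\mu(x,y)\rangle$. Let $\Gamma_v(T)=\Re_vT-T\Re_v$ for $v\in\mathcal D$, $T\in\mathrm{End}(\Lambda\mathcal G)$. Let $(e_i)$ be a basis of $\mathcal G$ with dual basis $(\xi^i)$, let $\mathbf r=\frac12\sum_i e_i\wedge\xi^i\in\Lambda^2\mathcal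 D$ and $\exp_\wedge\mathbf r=1+\mathbf r+\frac1{2!}\mathbf r\wedge\mathbf r+\frac1{3!}\mathbf r\wedge\mathbf r\wedge\mathbf r+\cdots\in\Lambda\mathcal D$. Identify $\mathcal D$ with $\mathcal D^*$ by the scalar product $\langle x+\xi,y+\eta\rangle=\langle\xi,y\rangle+\langle\eta,x\rangle$, so that $i_W$ acts on $\Lambda\mathcal D$ for $W\in\Lambda\mathcal D$. For $A=\xi_1\wedge\dots\wedge\xi_k$ let $\hat A=\xi_k\wedge\dots\wedge\xi_1$. For $U\in\Lambda\mathcal D$ write $i_{\exp_\wedge\mathbf r}U=\sum_jX_j\otimes A_j\in\Lambda\mathcal D\cong\Lambda\mathcal G\otimes\Lambda\mathcal G^*$ (where $X\otimes A$ corresponds to $X\wedge A$) and define $Q(U)\in\mathrm{End}(\Lambda\mathcal G)$ by $Q(U)(Y)=\sum_jX_j\wedge i_{\hat A_j}Y$. Then $[\cdot,\cdot]_{\mathcal D}$ is a Lie bracket, the adjoint action on $\Lambda\mathcal D$ and $\Gamma$ on $\mathrm{End}(\Lambda\mathcal G)$ are representations of $\mathcal D$, and $Q:\Lambda\mathcal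 D\to\mathrm{End}(\Lambda\mathcal G)$ is an isomorphism of $\mathcal D$-modules: it is a linear bijection and $Q(ad_vU)=\Gamma_v(Q(U))$ for all $v\in\mathcal D$, $U\in\Lambda\mathcal D$. -/

import Mathlib

open scoped TensorProduct ExteriorAlgebra

noncomputable section

namespace LieQuasi

/-! ### Operations on exterior algebras -/

section Exterior

variable {K : Type*} [Field K] {M : Type*} [AddCommGroup M] [Module K M]

/-- The algebra homomorphism `Λ M* → End (Λ M)` sending `ξ ∈ M*` to the interior product `i_ξ`
(the antiderivation of degree `-1` with `i_ξ x = ⟨ξ, x⟩`, which is the transpose of `ξ ∧ ·`).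
It sends `ξ₁ ∧ … ∧ ξₘ` to `i_{ξ₁} ∘ … ∘ i_{ξₘ}`. -/
def contractHom :
    ExteriorAlgebra K (Module.Dual K M) →ₐ[K] Module.End K (ExteriorAlgebra K M) :=
  ExteriorAlgebra.lift K
    ⟨CliffordAlgebra.contractLeft (Q := (0 : QuadraticForm K M)), fun ξ =>
      LinearMap.ext fun X => CliffordAlgebra.contractLeft_contractLeft (d := ξ) X⟩

/-- The reversal `A ↦ Â`, `ξ₁ ∧ … ∧ ξₘ ↦ ξₘ ∧ … ∧ ξ₁`. -/
def hat : ExteriorAlgebra K M →ₗ[K] ExteriorAlgebra K M :=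
  CliffordAlgebra.reverse (Q := (0 : QuadraticForm K M))

/-- The interior product `i_A` on `Λ M` by `A ∈ Λ M*`, i.e. the transpose of left exterior
multiplication by `A`; thus `i_{ξ₁ ∧ … ∧ ξₘ} = i_{ξₘ} ∘ … ∘ i_{ξ₁}`. -/
def interior :
    ExteriorAlgebra K (Module.Dual K M) →ₗ[K] Module.End K (ExteriorAlgebra K M) :=
  contractHom.toLinearMap ∘ₗ hat

theorem interior_one : interior (K := K) (M := M) 1 = 1 := by
  simp [interior, hat]

theorem interior_ι (ξ : Module.Dual K M) (X : ExteriorAlgebra K M) :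
    interior (ExteriorAlgebra.ι K ξ) X
      = CliffordAlgebra.contractLeft (Q := (0 : QuadraticForm K M)) ξ X := by
  have h : hat (ExteriorAlgebra.ι K ξ) = ExteriorAlgebra.ι K ξ :=
    CliffordAlgebra.reverse_ι ξ
  simp [interior, h, contractHom]

theorem interior_mul (A B : ExteriorAlgebra K (Module.Dual K M)) :
    interior (A * B) = interior B * interior A := by
  have h : hat (A * B) = hat B * hat A := CliffordAlgebra.reverse.map_mul A B
  simp [interior, h]

/-- The duality bracket `⟨A, X⟩` between `Λ M*` and `Λ M`:
the component of degree `0` of `i_A X`. -/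
def pairing : ExteriorAlgebra K (Module.Dual K M) →ₗ[K] ExteriorAlgebra K M →ₗ[K] K :=
  (LinearMap.llcomp K _ _ K (ExteriorAlgebra.algebraMapInv (R := K) (M := M)).toLinearMap)
    ∘ₗ interior

theorem pairing_apply (A : ExteriorAlgebra K (Module.Dual K M)) (X : ExteriorAlgebra K M) :
    pairing A X = ExteriorAlgebra.algebraMapInv (interior A X) := rfl

/-- `i_A` is the transpose of left multiplication by `A`. -/
theorem pairing_interior (A B : ExteriorAlgebra K (Module.Dual K M)) (X : ExteriorAlgebra K M) :
    pairing B (interior A X) = pairing (A * B) X := by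
  simp [pairing_apply, interior_mul]

theorem pairing_ι_mul_ι (ξ η : Module.Dual K M) (x y : M) :
    pairing (ExteriorAlgebra.ι K ξ * ExteriorAlgebra.ι K η)
      (ExteriorAlgebra.ι K x * ExteriorAlgebra.ι K y) = ξ x * η y - ξ y * η x := by
  rw [pairing_apply, interior_mul, Module.End.mul_apply, interior_ι, interior_ι,
    ExteriorAlgebra.ι, CliffordAlgebra.contractLeft_ι_mul, CliffordAlgebra.contractLeft_ι,
    map_sub, map_smul, CliffordAlgebra.contractLeft_ι, CliffordAlgebra.contractLeft_mul_algebraMap,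
    CliffordAlgebra.contractLeft_ι, map_sub, map_smul, map_mul]
  have h : ∀ c : K, ExteriorAlgebra.algebraMapInv (R := K) (M := M) (algebraMap K _ c) = c :=
    ExteriorAlgebra.algebraMap_leftInverse M
  rw [h, h, h, smul_eq_mul]
  ring

/-- Auxiliary algebra homomorphism `X ↦ X + ε D(X)` into the dual numbers over `Λ M`,
where `D` is the derivation extending `f`. -/
def derivHom (f : Module.End K M) :
    ExteriorAlgebra K M →ₐ[K] DualNumber (ExteriorAlgebra K M) :=
  ExteriorAlgebra.lift K
    ⟨{  toFun := fun m => TrivSqZeroExt.inl (ExteriorAlgebra.ι K m)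
          + TrivSqZeroExt.inr (ExteriorAlgebra.ι K (f m))
        map_add' := fun a b => by ext <;> simp
        map_smul' := fun c a => by ext <;> simp },
      fun m => by
        ext
        · simp
        · simp [ExteriorAlgebra.ι_add_mul_swap (R := K) m (f m)]⟩

theorem derivHom_fst (f : Module.End K M) (X : ExteriorAlgebra K M) :
    (derivHom f X).fst = X := by
  have h : (TrivSqZeroExt.fstHom K (ExteriorAlgebra K M) (ExteriorAlgebra K M)).comp (derivHom f)
      = AlgHom.id K _ := by
    ext m
    simp [derivHom]
  exact DFunLike.congr_fun h X

/-- The derivation of degree `0` of `(Λ M, ∧)` extending `f ∈ End M`: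
`x₁ ∧ … ∧ xₘ ↦ ∑ᵢ x₁ ∧ … ∧ f xᵢ ∧ … ∧ xₘ`. -/
def derivFun (f : Module.End K M) : Module.End K (ExteriorAlgebra K M) :=
  { toFun := fun X => (derivHom f X).snd
    map_add' := fun X Y => by simp
    map_smul' := fun c X => by simp }

theorem derivFun_ι (f : Module.End K M) (m : M) :
    derivFun f (ExteriorAlgebra.ι K m) = ExteriorAlgebra.ι K (f m) := by
  simp [derivFun, derivHom]

theorem derivFun_algebraMap (f : Module.End K M) (c : K) :
    derivFun f (algebraMap K _ c) = 0 := by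
  change (derivHom f (algebraMap K _ c)).snd = 0
  rw [AlgHom.commutes]
  rfl

theorem derivFun_mul (f : Module.End K M) (X Y : ExteriorAlgebra K M) :
    derivFun f (X * Y) = derivFun f X * Y + X * derivFun f Y := by
  simp [derivFun, derivHom_fst, add_comm]

/-- `derivFun` as a linear map in the endomorphism. -/
def deriv : Module.End K M →ₗ[K] Module.End K (ExteriorAlgebra K M) where
  toFun := derivFun
  map_add' f g := by
    refine LinearMap.ext fun X => ?_
    induction X using ExteriorAlgebra.induction with
    | algebraMap r => simp [derivFun_algebraMap]
    | ι x => simp [derivFun_ι]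
    | mul a b ha hb =>
      rw [derivFun_mul, ha, hb]
      simp only [LinearMap.add_apply, derivFun_mul, add_mul, mul_add]
      abel
    | add a b ha hb => rw [map_add, ha, hb, map_add]
  map_smul' c f := by
    refine LinearMap.ext fun X => ?_
    induction X using ExteriorAlgebra.induction with
    | algebraMap r => simp [derivFun_algebraMap]
    | ι x => simp [derivFun_ι]
    | mul a b ha hb =>
      rw [derivFun_mul, ha, hb]
      simp [derivFun_mul, smul_add]
    | add a b ha hb => rw [map_add, ha, hb, map_add]

/-- Left exterior multiplication `ε_X`. -/
def wedge : ExteriorAlgebra K M →ₗ[K] Module.End K (ExteriorAlgebra K M) :=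
  LinearMap.mul K (ExteriorAlgebra K M)

/-- The linear map `Λ M ⊗ Λ N → Λ (M × N)`, `X ⊗ A ↦ X ∧ A`. -/
def tensorToExterior {N : Type*} [AddCommGroup N] [Module K N] :
    ExteriorAlgebra K M ⊗[K] ExteriorAlgebra K N →ₗ[K] ExteriorAlgebra K (M × N) :=
  TensorProduct.lift
    ((LinearMap.mul K (ExteriorAlgebra K (M × N))).compl₁₂
      (ExteriorAlgebra.map (LinearMap.inl K M N)).toLinearMap
      (ExteriorAlgebra.map (LinearMap.inr K M N)).toLinearMap)

theorem tensorToExterior_tmul {N : Type*} [AddCommGroup N] [Module K N]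
    (X : ExteriorAlgebra K M) (A : ExteriorAlgebra K N) :
    tensorToExterior (X ⊗ₜ[K] A)
      = ExteriorAlgebra.map (LinearMap.inl K M N) X
        * ExteriorAlgebra.map (LinearMap.inr K M N) A := by
  simp [tensorToExterior]

theorem tensorToExterior_bijective {N : Type*} [AddCommGroup N] [Module K N] :
    Function.Bijective (tensorToExterior (K := K) (M := M) (N := N)) := by
  have hQ : (0 : QuadraticForm K M).prod (0 : QuadraticForm K N) = 0 := by
    ext; simp
  let I : ((0 : QuadraticForm K M).prod (0 : QuadraticForm K N)).IsometryEquiv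
      (0 : QuadraticForm K (M × N)) :=
    { LinearEquiv.refl K (M × N) with map_app' := fun m => by simp }
  let e : ExteriorAlgebra K M ⊗[K] ExteriorAlgebra K N ≃ₗ[K] ExteriorAlgebra K (M × N) :=
    (GradedTensorProduct.of K (CliffordAlgebra.evenOdd (0 : QuadraticForm K M))
      (CliffordAlgebra.evenOdd (0 : QuadraticForm K N))).trans
    ((CliffordAlgebra.prodEquiv _ _).symm.toLinearEquiv.trans
      (CliffordAlgebra.equivOfIsometry I).toLinearEquiv)
  have he : (tensorToExterior (K := K) (M := M) (N := N)) = e.toLinearMap := by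
    apply TensorProduct.ext'
    intro X A
    rw [tensorToExterior_tmul]
    have h1 : (CliffordAlgebra.equivOfIsometry I).toAlgHom.comp
        (CliffordAlgebra.map (QuadraticMap.Isometry.inl (0 : QuadraticForm K M)
          (0 : QuadraticForm K N))) = ExteriorAlgebra.map (LinearMap.inl K M N) := by
      ext m; simp; rfl
    have h2 : (CliffordAlgebra.equivOfIsometry I).toAlgHom.comp
        (CliffordAlgebra.map (QuadraticMap.Isometry.inr (0 : QuadraticForm K M)
          (0 : QuadraticForm K N))) = ExteriorAlgebra.map (LinearMap.inr K M N) := by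
      ext m; simp; rfl
    rw [← h1, ← h2]
    change _ = CliffordAlgebra.equivOfIsometry I
      (CliffordAlgebra.toProd 0 0 (GradedTensorProduct.tmul K X A))
    rw [CliffordAlgebra.toProd, GradedTensorProduct.lift_tmul, map_mul]
    rfl
  rw [he]
  exact e.bijective

/-- The identification `Λ M ⊗ Λ N ≅ Λ (M ⊕ N)`, `X ⊗ A ↦ X ∧ A`. -/
def tensorEquivExterior {N : Type*} [AddCommGroup N] [Module K N] :
    ExteriorAlgebra K M ⊗[K] ExteriorAlgebra K N ≃ₗ[K] ExteriorAlgebra K (M × N) :=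
  LinearEquiv.ofBijective tensorToExterior tensorToExterior_bijective

end Exterior

/-! ### Operations on tensor powers -/

section Tensor

variable {K : Type*} [Field K] {M : Type*} [AddCommGroup M] [Module K M]

/-- The alternator `x₁ ⊗ … ⊗ xₙ ↦ ∑_σ sign(σ) x_{σ(1)} ⊗ … ⊗ x_{σ(n)}`. -/
def alt (n : ℕ) : ⨂[K]^n M →ₗ[K] ⨂[K]^n M :=
  ∑ σ : Equiv.Perm (Fin n),
    (Equiv.Perm.sign σ : ℤ) • (PiTensorProduct.reindex K (fun _ : Fin n => M) σ).toLinearMap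

/-- The inclusion `Λⁿ M ⊆ M^{⊗ n}`,
`x₁ ∧ … ∧ xₙ ↦ ∑_σ sign(σ) x_{σ(1)} ⊗ … ⊗ x_{σ(n)}`. -/
def toTensor (n : ℕ) : ⋀[K]^n M →ₗ[K] ⨂[K]^n M :=
  exteriorPower.toTensorPower K M n

/-- The action of `f ∈ End M` on the tensor power:
`x₁ ⊗ … ⊗ xₙ ↦ ∑ᵢ x₁ ⊗ … ⊗ f xᵢ ⊗ … ⊗ xₙ`. -/
def tensorAction (n : ℕ) (f : Module.End K M) : ⨂[K]^n M →ₗ[K] ⨂[K]^n M :=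
  ∑ i : Fin n, PiTensorProduct.map (Function.update (fun _ => LinearMap.id) i f)

/-- `γ ⊗ 1 ⊗ … ⊗ 1 : M^{⊗ (1 + n)} → M^{⊗ (2 + n)}` for `γ : M → Λ² M`. -/
def applyFirst (γ : M →ₗ[K] ⋀[K]^2 M) (n : ℕ) : ⨂[K]^(1 + n) M →ₗ[K] ⨂[K]^(2 + n) M :=
  TensorPower.mulEquiv.toLinearMap
    ∘ₗ TensorProduct.map
        (toTensor 2 ∘ₗ γ ∘ₗ (PiTensorProduct.subsingletonEquiv (0 : Fin 1)).toLinearMap)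
        LinearMap.id
    ∘ₗ TensorPower.mulEquiv.symm.toLinearMap

end Tensor

end LieQuasi

open LieQuasi

/-- A Lie quasi-bialgebra structure on the Lie algebra `G` (whose bracket is `μ`). -/
structure LieQuasiBialgebra (K : Type*) (G : Type*) [Field K] [LieRing G] [LieAlgebra K G] where
  /-- the cobracket `γ : G → Λ² G` -/
  cobracket : G →ₗ[K] ⋀[K]^2 G
  /-- the element `φ ∈ Λ³ G` -/
  phi : ⋀[K]^3 G
  /-- `γ` is a 1-cocycle: `γ (μ (x, y)) = x · γ y - y · γ x` -/
  cocycle : ∀ x y : G, toTensor 2 (cobracket ⁅x, y⁆)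
    = tensorAction 2 (LieAlgebra.ad K G x) (toTensor 2 (cobracket y))
      - tensorAction 2 (LieAlgebra.ad K G y) (toTensor 2 (cobracket x))
  /-- `½ Alt (γ ⊗ 1) γ (x) = - (δ_μ φ) (x)`, where `(δ_μ φ) (x) = x · φ` -/
  quasi_coJacobi : ∀ x : G,
    (1 / 2 : K) • alt 3 (applyFirst cobracket 1 (toTensor 2 (cobracket x)))
      = - tensorAction 3 (LieAlgebra.ad K G x) (toTensor 3 phi)
  /-- `Alt (γ ⊗ 1 ⊗ 1) (φ) = 0` -/
  alt_phi : alt 4 (applyFirst cobracket 2 (toTensor 3 phi)) = 0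

namespace LieQuasiBialgebra

variable {K : Type*} [Field K] {G : Type*} [LieRing G] [LieAlgebra K G]

section Double

/-- The coadjoint action `ad_x^{μ*} ξ`: `⟨ad_x^{μ*} ξ, y⟩ = - ⟨ξ, μ (x, y)⟩`. -/
def adStarMu : G →ₗ[K] Module.Dual K G →ₗ[K] Module.Dual K G :=
  LinearMap.mk₂ K (fun x ξ => -(ξ ∘ₗ (LieAlgebra.ad K G x : Module.End K G)))
    (fun x y ξ => by ext z; simp; ring) (fun c x ξ => by ext z; simp)
    (fun x ξ η => by ext z; simp; ring) (fun c x ξ => by ext z; simp)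

/-- The bracket `γ (ξ, η)` on `G*`, the opposite of the transpose of the cobracket:
`⟨γ x, ξ ∧ η⟩ = - ⟨x, γ (ξ, η)⟩`. -/
def dualBracket (S : LieQuasiBialgebra K G) :
    Module.Dual K G →ₗ[K] Module.Dual K G →ₗ[K] Module.Dual K G :=
  LinearMap.mk₂ K
    (fun ξ η => -(pairing (ExteriorAlgebra.ι K ξ * ExteriorAlgebra.ι K η)
      ∘ₗ (⋀[K]^2 G).subtype ∘ₗ S.cobracket))
    (fun ξ ξ' η => by ext z; simp [add_mul]; ring) (fun c ξ η => by ext z; simp)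
    (fun ξ η η' => by ext z; simp [mul_add]; ring) (fun c ξ η => by ext z; simp)

variable [FiniteDimensional K G]

/-- `ad_ξ^{γ*} x ∈ G`: `⟨ad_ξ^{γ*} x, η⟩ = - ⟨x, γ (ξ, η)⟩`. -/
def adStarGamma (S : LieQuasiBialgebra K G) : Module.Dual K G →ₗ[K] G →ₗ[K] G :=
  LinearMap.mk₂ K
    (fun ξ x => (Module.evalEquiv K G).symm (-(Module.Dual.eval K G x ∘ₗ S.dualBracket ξ)))
    (fun ξ ξ' x => by
      rw [← map_add]; congr 1; ext z; simp; ring)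
    (fun c ξ x => by
      rw [← map_smul]; congr 1; ext z; simp)
    (fun ξ x x' => by
      rw [← map_add]; congr 1; ext z; simp; ring)
    (fun c ξ x => by
      rw [← map_smul]; congr 1; ext z; simp)

theorem adStarGamma_apply (S : LieQuasiBialgebra K G) (ξ η : Module.Dual K G) (x : G) :
    η (S.adStarGamma ξ x) = - S.dualBracket ξ η x := by
  simp [adStarGamma, Module.apply_evalEquiv_symm_apply]

/-- `φ (ξ, η) = i_{ξ ∧ η} φ ∈ G`. -/
def phiMap (S : LieQuasiBialgebra K G) :
    Module.Dual K G →ₗ[K] Module.Dual K G →ₗ[K] G :=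
  LinearMap.mk₂ K
    (fun ξ η => ExteriorAlgebra.ιInv
      (interior (ExteriorAlgebra.ι K ξ * ExteriorAlgebra.ι K η) (S.phi : ExteriorAlgebra K G)))
    (fun ξ ξ' η => by simp [add_mul]) (fun c ξ η => by simp)
    (fun ξ η η' => by simp [mul_add]) (fun c ξ η => by simp)

/-- The bracket of the double `D = G ⊕ G*`:
`[x, y] = μ (x, y)`, `[x, ξ] = - ad_ξ^{γ*} x + ad_x^{μ*} ξ`, `[ξ, η] = φ (ξ, η) + γ (ξ, η)`,
extended bilinearly and antisymmetrically. -/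
def doubleBracket (S : LieQuasiBialgebra K G) :
    (G × Module.Dual K G) →ₗ[K] (G × Module.Dual K G) →ₗ[K] (G × Module.Dual K G) :=
  LinearMap.mk₂ K
    (fun u v =>
      (⁅u.1, v.1⁆ - S.adStarGamma v.2 u.1 + S.adStarGamma u.2 v.1 + S.phiMap u.2 v.2,
        adStarMu u.1 v.2 - adStarMu v.1 u.2 + S.dualBracket u.2 v.2))
    (fun u u' v => by
      ext1
      · simp; abel
      · simp; abel)
    (fun c u v => by
      ext1
      · simp [smul_add, smul_sub]
      · simp [smul_add, smul_sub])
    (fun u v v' => by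
      ext1
      · simp; abel
      · simp; abel)
    (fun c u v => by
      ext1
      · simp [smul_add, smul_sub]
      · simp [smul_add, smul_sub])

/-- The adjoint action of `D` on `Λ D`, each `ad_v` acting as a derivation. -/
def adExterior (S : LieQuasiBialgebra K G) :
    (G × Module.Dual K G) →ₗ[K] Module.End K (ExteriorAlgebra K (G × Module.Dual K G)) :=
  deriv ∘ₗ S.doubleBracket

end Double

section Rep

variable [FiniteDimensional K G]

/-- `d_μ ξ ∈ Λ² G*`, the Chevalley–Eilenberg differential of `ξ ∈ G*`; it is characterized by
`⟨d_μ ξ, x ∧ y⟩ = - ξ (μ (x, y))`, and written here in an (arbitrary) basis of `G`. -/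
def dMu : Module.Dual K G →ₗ[K] ExteriorAlgebra K (Module.Dual K G) :=
  let e := Module.finBasis K G
  (1 / 2 : K) • ∑ i, wedge (ExteriorAlgebra.ι K (e.coord i))
    ∘ₗ ExteriorAlgebra.ι K ∘ₗ adStarMu (e i)

theorem pairing_dMu (ξ : Module.Dual K G) (x y : G) (h2 : (2 : K) ≠ 0) :
    pairing (dMu ξ) (ExteriorAlgebra.ι K x * ExteriorAlgebra.ι K y) = - ξ ⁅x, y⁆ := by
  have h : ∀ z : G, ∑ i, (Module.finBasis K G).coord i z • Module.finBasis K G i = z :=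
    fun z => (Module.finBasis K G).sum_repr z
  have key : ∀ z w : G, ∑ i, (Module.finBasis K G).coord i z *
      adStarMu (Module.finBasis K G i) ξ w = - ξ ⁅z, w⁆ := by
    intro z w
    have hz : ξ ⁅z, w⁆ = ξ ⁅∑ i, (Module.finBasis K G).coord i z • Module.finBasis K G i, w⁆ := by
      rw [h z]
    rw [hz]
    simp only [adStarMu, LinearMap.mk₂_apply, LinearMap.neg_apply, LinearMap.comp_apply,
      LieAlgebra.ad_apply, sum_lie, smul_lie, map_sum, map_smul, smul_eq_mul, mul_neg,
      Finset.sum_neg_distrib]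
  have : pairing (dMu ξ) (ExteriorAlgebra.ι K x * ExteriorAlgebra.ι K y)
      = (1 / 2 : K) * ∑ i, ((Module.finBasis K G).coord i x * adStarMu (Module.finBasis K G i) ξ y
        - (Module.finBasis K G).coord i y * adStarMu (Module.finBasis K G i) ξ x) := by
    simp only [dMu, LinearMap.smul_apply, LinearMap.sum_apply, LinearMap.comp_apply, map_smul,
      map_sum, wedge, LinearMap.mul_apply', pairing_ι_mul_ι, smul_eq_mul]
  rw [this, Finset.sum_sub_distrib, key, key, ← lie_skew x y, map_neg]
  field_simp
  ring

/-- The representation `ℜ` of the double on `Λ G`: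
`ℜ_x Y = d_γ x ∧ Y + ad_x^μ Y - ½ tr (ad_x^μ) Y` (with `d_γ x = γ x`),
`ℜ_ξ Y = - i_{d_μ ξ} Y + ad_ξ^{γ*} Y - i_ξ φ ∧ Y + ½ tr (ad_ξ^γ) Y`. -/
def rep (S : LieQuasiBialgebra K G) :
    (G × Module.Dual K G) →ₗ[K] Module.End K (ExteriorAlgebra K G) :=
  LinearMap.coprod
    (wedge ∘ₗ (⋀[K]^2 G).subtype ∘ₗ S.cobracket
      + deriv ∘ₗ (LieAlgebra.ad K G : G →ₗ[K] Module.End K G)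
      - (1 / 2 : K) • (LinearMap.trace K G ∘ₗ (LieAlgebra.ad K G : G →ₗ[K] Module.End K G)).smulRight
          (1 : Module.End K (ExteriorAlgebra K G)))
    (-(interior ∘ₗ dMu)
      + deriv ∘ₗ S.adStarGamma
      - wedge ∘ₗ (interior.flip (S.phi : ExteriorAlgebra K G)) ∘ₗ ExteriorAlgebra.ι K
      + (1 / 2 : K) • (LinearMap.trace K (Module.Dual K G) ∘ₗ S.dualBracket).smulRight
          (1 : Module.End K (ExteriorAlgebra K G)))

/-- The commutator action `Γ_v T = ℜ_v T - T ℜ_v` of the double on `End (Λ G)`. -/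
def commAction (S : LieQuasiBialgebra K G) :
    (G × Module.Dual K G) →ₗ[K] Module.End K (Module.End K (ExteriorAlgebra K G)) :=
  LinearMap.mk₂ K (fun v T => S.rep v * T - T * S.rep v)
    (fun u v T => by rw [map_add, add_mul, mul_add]; abel)
    (fun c v T => by rw [map_smul, smul_mul_assoc, mul_smul_comm, smul_sub])
    (fun v T T' => by rw [add_mul, mul_add]; abel)
    (fun c v T => by rw [smul_mul_assoc, mul_smul_comm, smul_sub])

end Rep

end LieQuasiBialgebra

namespace LieQuasi

/-- A bilinear bracket is a Lie bracket: it is alternating and satisfies the Jacobi identity. -/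
def IsLieBracket {K D : Type*} [Field K] [AddCommGroup D] [Module K D]
    (br : D →ₗ[K] D →ₗ[K] D) : Prop :=
  (∀ u, br u u = 0) ∧ ∀ u v w, br u (br v w) + br v (br w u) + br w (br u v) = 0

/-- The linear map `ρ : D → End V` is a representation of `(D, br)`. -/
def IsLieRepresentation {K D V : Type*} [Field K] [AddCommGroup D] [Module K D]
    [AddCommGroup V] [Module K V] (br : D →ₗ[K] D →ₗ[K] D) (ρ : D →ₗ[K] Module.End K V) : Prop :=
  ∀ u v, ρ (br u v) = ρ u * ρ v - ρ v * ρ u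

section Quantization

variable {K : Type*} [Field K] {G : Type*} [AddCommGroup G] [Module K G]

/-- The canonical scalar product `⟨x + ξ, y + η⟩ = ⟨ξ, y⟩ + ⟨x, η⟩` on `D = G ⊕ G*`,
as the linear map `D → D*`. -/
def scalarProduct : (G × Module.Dual K G) →ₗ[K] Module.Dual K (G × Module.Dual K G) :=
  LinearMap.mk₂ K (fun u v => u.2 v.1 + v.2 u.1)
    (fun u u' v => by simp; ring) (fun c u v => by simp; ring)
    (fun u v v' => by simp; ring) (fun c u v => by simp; ring)

/-- The interior product `i_W` on `Λ D` for `W ∈ Λ D`, where `D ≅ D*` by the scalar product. -/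
def interiorDouble : ExteriorAlgebra K (G × Module.Dual K G) →ₗ[K]
    Module.End K (ExteriorAlgebra K (G × Module.Dual K G)) :=
  interior ∘ₗ (ExteriorAlgebra.map scalarProduct).toLinearMap

variable {ι : Type*} [Fintype ι]

/-- `r = ½ ∑ᵢ eᵢ ∧ ξⁱ ∈ Λ² D`, with `(ξⁱ)` the basis dual to `(eᵢ)`. -/
def rMatrix (e : Module.Basis ι K G) : ExteriorAlgebra K (G × Module.Dual K G) :=
  (1 / 2 : K) • ∑ i, ExteriorAlgebra.ι K (e i, (0 : Module.Dual K G))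
    * ExteriorAlgebra.ι K ((0 : G), e.coord i)

/-- `exp_∧ r = 1 + r + (1 / 2!) r ∧ r + (1 / 3!) r ∧ r ∧ r + …`; the powers beyond `dim G` vanish
because `r ^ n ∈ Λ^{2 n} D` and `dim D = 2 dim G`. -/
def expR (e : Module.Basis ι K G) : ExteriorAlgebra K (G × Module.Dual K G) :=
  ∑ n ∈ Finset.range (Fintype.card ι + 1), ((n.factorial : K)⁻¹) • rMatrix e ^ n

/-- The linear map `Λ G ⊗ Λ G* → End (Λ G)`, `X ⊗ A ↦ (Y ↦ X ∧ i_Â Y)`. -/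
def tensorToEnd : ExteriorAlgebra K G ⊗[K] ExteriorAlgebra K (Module.Dual K G) →ₗ[K]
    Module.End K (ExteriorAlgebra K G) :=
  TensorProduct.lift
    ((LinearMap.mul K (Module.End K (ExteriorAlgebra K G))).compl₁₂ wedge (interior ∘ₗ hat))

/-- The map `Q : Λ D → End (Λ G)`, `Q U Y = ∑ⱼ Xⱼ ∧ i_{Âⱼ} Y` where
`i_{exp_∧ r} U = ∑ⱼ Xⱼ ⊗ Aⱼ` in `Λ D ≅ Λ G ⊗ Λ G*`. -/
def qMap (e : Module.Basis ι K G) :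
    ExteriorAlgebra K (G × Module.Dual K G) →ₗ[K] Module.End K (ExteriorAlgebra K G) :=
  tensorToEnd ∘ₗ tensorEquivExterior.symm.toLinearMap ∘ₗ interiorDouble (expR e)

theorem qMap_apply (e : Module.Basis ι K G) (U : ExteriorAlgebra K (G × Module.Dual K G))
    {J : Type*} (s : Finset J) (X : J → ExteriorAlgebra K G)
    (A : J → ExteriorAlgebra K (Module.Dual K G))
    (h : interiorDouble (expR e) U = ∑ j ∈ s,
      ExteriorAlgebra.map (LinearMap.inl K G (Module.Dual K G)) (X j)
        * ExteriorAlgebra.map (LinearMap.inr K G (Module.Dual K G)) (A j))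
    (Y : ExteriorAlgebra K G) :
    qMap e U Y = ∑ j ∈ s, X j * interior (hat (A j)) Y := by
  have h' : interiorDouble (expR e) U = tensorEquivExterior (∑ j ∈ s, X j ⊗ₜ[K] A j) := by
    rw [h, map_sum]
    exact Finset.sum_congr rfl fun j _ => (tensorToExterior_tmul (X j) (A j)).symm
  change tensorToEnd (tensorEquivExterior.symm (interiorDouble (expR e) U)) Y = _
  rw [h', LinearEquiv.symm_apply_apply, map_sum, LinearMap.sum_apply]
  rfl

end Quantization

end LieQuasi

end

/-! `Q` is the Weyl (antisymmetrized) quantization of `Λ D` by Clifford operators on the spinor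
module `Λ G`, where a vector acts by exterior multiplication and a covector by contraction
(`spinor`). The bare map `X ∧ A ↦ X ∧ i_Â` is normal ordering: it sends `x ∧ U` to `x · N(U)` but `ξ
∧ U` to `ξ · N(U) - N(i_ξ U)`. Contracting with `exp r` first spreads this correction evenly over
vectors and covectors, because `[i_r, v ∧ ·] = ½ i_{(-x, ξ)}` for `v = x + ξ`. The result is the
recursion `Q(v ∧ U) = v · Q(U) - ½ Q(i_v U)` (`qMap_ι_mul`), which together with `Q(1) = 1`
determines `Q` (`eq_zero_of_clifford_recursion`).

Equivariance then needs only two facts about generators: `[ℜ_v, u ·] = [v, u] ·`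
(`rep_commutator_spinor`), and invariance of the scalar product (`scalarProduct_doubleBracket`),
which governs how `ad_v` passes `i_u`. They show that `Q ∘ ad_v - Γ_v ∘ Q` obeys the same recursion
and kills `1`, hence is zero. The trace terms of `ℜ` are scalars and drop out of every commutator.

For bijectivity, `i_{exp r}` is the identity plus a nilpotent. Normal ordering is onto because the
projection of `Λ G` onto scalars is a normally ordered operator from which every endomorphism can be
built; equality of dimensions does the rest.

For the Jacobi identity, invariance turns the Jacobiator into the cyclic sum of `⟨[u, v], [w, z]⟩`.
Sorted by the number of covectors among the four arguments, its vanishing is Jacobi for `μ`, the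
cocycle condition, the quasi co-Jacobi identity and `Alt (γ ⊗ 1 ⊗ 1) φ = 0`. The adjoint action on
`Λ D` is then a representation, and `Γ` inherits this through `Q`, so `ℜ` itself never has to be
shown to be one. -/

namespace LieQuasi

/-! ### Calculus of contractions and derivations on the exterior algebra. -/

section Exterior

variable {K : Type*} [Field K] {M : Type*} [AddCommGroup M] [Module K M]

theorem interior_ι_ι_mul (ξ : Module.Dual K M) (x : M) (X : ExteriorAlgebra K M) :
    interior (ExteriorAlgebra.ι K ξ) (ExteriorAlgebra.ι K x * X)
      = ξ x • X - ExteriorAlgebra.ι K x * interior (ExteriorAlgebra.ι K ξ) X := by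
  simp only [interior_ι]
  exact CliffordAlgebra.contractLeft_ι_mul ξ x X

theorem interior_ι_one (ξ : Module.Dual K M) :
    interior (ExteriorAlgebra.ι K ξ) (1 : ExteriorAlgebra K M) = 0 := by
  rw [interior_ι]
  exact CliffordAlgebra.contractLeft_one (Q := (0 : QuadraticForm K M)) (d := ξ)

theorem interior_ι_apply_ι (ξ : Module.Dual K M) (x : M) :
    interior (ExteriorAlgebra.ι K ξ) (ExteriorAlgebra.ι K x) = algebraMap K _ (ξ x) := by
  rw [interior_ι]
  exact CliffordAlgebra.contractLeft_ι (0 : QuadraticForm K M) ξ x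

theorem interior_ι_comm (ξ η : Module.Dual K M) (X : ExteriorAlgebra K M) :
    interior (ExteriorAlgebra.ι K ξ) (interior (ExteriorAlgebra.ι K η) X)
      = -interior (ExteriorAlgebra.ι K η) (interior (ExteriorAlgebra.ι K ξ) X) := by
  simp only [interior_ι]
  exact CliffordAlgebra.contractLeft_comm ..

theorem interior_ι_interior_ι (ξ : Module.Dual K M) (X : ExteriorAlgebra K M) :
    interior (ExteriorAlgebra.ι K ξ) (interior (ExteriorAlgebra.ι K ξ) X) = 0 := by
  simp only [interior_ι]
  exact CliffordAlgebra.contractLeft_contractLeft ..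

theorem ι_mul_ι_comm (x y : M) :
    ExteriorAlgebra.ι K x * ExteriorAlgebra.ι K y
      = -(ExteriorAlgebra.ι K y * ExteriorAlgebra.ι K x) :=
  eq_neg_of_add_eq_zero_left (ExteriorAlgebra.ι_add_mul_swap x y)

/-- Induction on the exterior algebra by left multiplication by vectors. -/
theorem exteriorAlgebra_left_induction {P : ExteriorAlgebra K M → Prop}
    (h1 : P 1) (smul : ∀ (c : K) X, P X → P (c • X)) (add : ∀ X Y, P X → P Y → P (X + Y))
    (mul : ∀ x X, P X → P (ExteriorAlgebra.ι K x * X)) (X : ExteriorAlgebra K M) : P X :=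
  CliffordAlgebra.left_induction (Q := (0 : QuadraticForm K M))
    (fun r => by rw [Algebra.algebraMap_eq_smul_one]; exact smul r 1 h1) add
    (fun X x h => mul x X h) X

/-- Induction on the exterior algebra by right multiplication by vectors. -/
theorem exteriorAlgebra_right_induction {P : ExteriorAlgebra K M → Prop}
    (h1 : P 1) (smul : ∀ (c : K) X, P X → P (c • X)) (add : ∀ X Y, P X → P Y → P (X + Y))
    (mul : ∀ x X, P X → P (X * ExteriorAlgebra.ι K x)) (X : ExteriorAlgebra K M) : P X :=
  CliffordAlgebra.right_induction (Q := (0 : QuadraticForm K M))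
    (fun r => by rw [Algebra.algebraMap_eq_smul_one]; exact smul r 1 h1) add
    (fun x X h => mul x X h) X

theorem deriv_ι (f : Module.End K M) (m : M) :
    deriv f (ExteriorAlgebra.ι K m) = ExteriorAlgebra.ι K (f m) := derivFun_ι f m

theorem deriv_one (f : Module.End K M) : deriv f (1 : ExteriorAlgebra K M) = 0 := by
  have := derivFun_algebraMap f 1
  rwa [map_one] at this

theorem deriv_mul (f : Module.End K M) (X Y : ExteriorAlgebra K M) :
    deriv f (X * Y) = deriv f X * Y + X * deriv f Y := derivFun_mul f X Y

theorem deriv_ι_mul (f : Module.End K M) (x : M) (Y : ExteriorAlgebra K M) :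
    deriv f (ExteriorAlgebra.ι K x * Y)
      = ExteriorAlgebra.ι K (f x) * Y + ExteriorAlgebra.ι K x * deriv f Y := by
  rw [deriv_mul, deriv_ι]

theorem deriv_commutator (f g : Module.End K M) :
    deriv (f * g - g * f) = deriv f * deriv g - deriv g * deriv f := by
  refine LinearMap.ext fun X => ?_
  induction X using exteriorAlgebra_left_induction with
  | h1 => simp [deriv_one]
  | smul c X h => rw [map_smul, map_smul, h]
  | add X Y hX hY => rw [map_add, map_add, hX, hY]
  | mul x X h =>
    rw [deriv_ι_mul, h]
    simp only [deriv_ι_mul, map_add, mul_sub, LinearMap.sub_apply, Module.End.mul_apply,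
      map_sub, sub_mul]
    abel

/-- The commutator of a contraction with an even derivation is again a contraction, so it is fixed
by its value on generators. -/
theorem interior_ι_deriv (f : Module.End K M) (d : Module.Dual K M) (X : ExteriorAlgebra K M) :
    interior (ExteriorAlgebra.ι K d) (deriv f X)
      = deriv f (interior (ExteriorAlgebra.ι K d) X)
        + interior (ExteriorAlgebra.ι K (d ∘ₗ f)) X := by
  induction X using exteriorAlgebra_left_induction with
  | h1 => simp [deriv_one, interior_ι_one]
  | smul c X h => simp only [map_smul, h, smul_add]
  | add X Y hX hY => simp only [map_add, hX, hY]; abel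
  | mul x X h =>
    simp only [deriv_ι_mul, map_add, h, mul_add, interior_ι_ι_mul, map_sub, map_smul,
      LinearMap.comp_apply]
    abel

theorem interior_ι_mul_ι_ι_mul (ξ η : Module.Dual K M) (x : M) (X : ExteriorAlgebra K M) :
    interior (ExteriorAlgebra.ι K ξ * ExteriorAlgebra.ι K η) (ExteriorAlgebra.ι K x * X)
      = ExteriorAlgebra.ι K x * interior (ExteriorAlgebra.ι K ξ * ExteriorAlgebra.ι K η) X
        + ξ x • interior (ExteriorAlgebra.ι K η) X - η x • interior (ExteriorAlgebra.ι K ξ) X := by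
  simp only [interior_mul, Module.End.mul_apply, interior_ι_ι_mul, map_sub, map_smul]
  abel

/-- Bivectors are linear combinations of decomposable ones. -/
@[elab_as_elim]
theorem bivector_induction {P : ExteriorAlgebra K M → Prop}
    (ι_mul : ∀ x y, P (ExteriorAlgebra.ι K x * ExteriorAlgebra.ι K y))
    (add : ∀ X Y, P X → P Y → P (X + Y)) {ω : ExteriorAlgebra K M} (h : ω ∈ ⋀[K]^2 M) : P ω := by
  rw [ExteriorAlgebra.exteriorPower, pow_two] at h
  induction h using Submodule.mul_induction_on' with
  | mem_mul_mem m hm n hn =>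
    obtain ⟨x, rfl⟩ := hm
    obtain ⟨y, rfl⟩ := hn
    exact ι_mul x y
  | add X _ Y _ hX hY => exact add X Y hX hY

/-- Trivectors are linear combinations of decomposable ones. -/
@[elab_as_elim]
theorem trivector_induction {P : ExteriorAlgebra K M → Prop}
    (ι_mul : ∀ x y z, P (ExteriorAlgebra.ι K x * (ExteriorAlgebra.ι K y * ExteriorAlgebra.ι K z)))
    (add : ∀ X Y, P X → P Y → P (X + Y)) {ω : ExteriorAlgebra K M} (h : ω ∈ ⋀[K]^3 M) : P ω := by
  rw [ExteriorAlgebra.exteriorPower, pow_succ'] at h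
  induction h using Submodule.mul_induction_on' with
  | mem_mul_mem m hm n hn =>
    obtain ⟨x, rfl⟩ := hm
    refine bivector_induction (P := fun n => P (ExteriorAlgebra.ι K x * n)) (fun y z => ι_mul x y z)
      (fun X Y hX hY => ?_) hn
    rw [mul_add]
    exact add _ _ hX hY
  | add X _ Y _ hX hY => exact add X Y hX hY

/-- Passing `x` through two vectors costs two signs, which cancel. -/
theorem bivector_mul_ι {ω : ExteriorAlgebra K M} (h : ω ∈ ⋀[K]^2 M) (x : M) :
    ω * ExteriorAlgebra.ι K x = ExteriorAlgebra.ι K x * ω := by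
  refine bivector_induction (fun y z => ?_) (fun X Y hX hY => ?_) h
  · rw [mul_assoc, ι_mul_ι_comm z x, mul_neg, ← mul_assoc, ι_mul_ι_comm y x, neg_mul, neg_neg,
      mul_assoc]
  · rw [add_mul, mul_add, hX, hY]

theorem interior_ι_bivector_mul {ω : ExteriorAlgebra K M} (h : ω ∈ ⋀[K]^2 M)
    (ξ : Module.Dual K M) (X : ExteriorAlgebra K M) :
    interior (ExteriorAlgebra.ι K ξ) (ω * X)
      = interior (ExteriorAlgebra.ι K ξ) ω * X + ω * interior (ExteriorAlgebra.ι K ξ) X := by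
  refine bivector_induction (fun y z => ?_) (fun X Y hX hY => ?_) h
  · simp only [mul_assoc, interior_ι_ι_mul, interior_ι_apply_ι, mul_sub, sub_mul, smul_mul_assoc,
      mul_smul_comm, Algebra.algebraMap_eq_smul_one, mul_one]
    abel
  · simp only [add_mul, map_add, hX, hY]; abel

theorem interior_ι_bivector_mem_range {ω : ExteriorAlgebra K M} (h : ω ∈ ⋀[K]^2 M)
    (ξ : Module.Dual K M) :
    interior (ExteriorAlgebra.ι K ξ) ω ∈ LinearMap.range (ExteriorAlgebra.ι K (M := M)) := by
  refine bivector_induction (fun y z => ?_) (fun X Y hX hY => ?_) h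
  · rw [interior_ι_ι_mul, interior_ι_apply_ι, Algebra.algebraMap_eq_smul_one, mul_smul_comm,
      mul_one, ← map_smul, ← map_smul, ← map_sub]
    exact ⟨_, rfl⟩
  · rw [map_add]; exact add_mem hX hY

theorem ι_ιInv_of_mem_range {X : ExteriorAlgebra K M}
    (h : X ∈ LinearMap.range (ExteriorAlgebra.ι K (M := M))) :
    ExteriorAlgebra.ι K (ExteriorAlgebra.ιInv (R := K) X) = X := by
  obtain ⟨x, rfl⟩ := h
  rw [ExteriorAlgebra.ι_leftInverse x]

theorem pairing_ι_ι (ξ : Module.Dual K M) (x : M) :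
    pairing (ExteriorAlgebra.ι K ξ) (ExteriorAlgebra.ι K x) = ξ x := by
  rw [pairing_apply, interior_ι_apply_ι]
  exact ExteriorAlgebra.algebraMap_leftInverse M _

theorem apply_ιInv_of_mem_range {X : ExteriorAlgebra K M}
    (h : X ∈ LinearMap.range (ExteriorAlgebra.ι K (M := M))) (ξ : Module.Dual K M) :
    ξ (ExteriorAlgebra.ιInv (R := K) X) = pairing (ExteriorAlgebra.ι K ξ) X := by
  obtain ⟨x, rfl⟩ := h
  rw [ExteriorAlgebra.ι_leftInverse x, pairing_ι_ι]

theorem interior_ι_trivector_mem {ω : ExteriorAlgebra K M} (h : ω ∈ ⋀[K]^3 M)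
    (ξ : Module.Dual K M) : interior (ExteriorAlgebra.ι K ξ) ω ∈ ⋀[K]^2 M := by
  have mem : ∀ x y : M, ExteriorAlgebra.ι K x * ExteriorAlgebra.ι K y ∈ ⋀[K]^2 M := fun x y => by
    rw [ExteriorAlgebra.exteriorPower, pow_two]
    exact Submodule.mul_mem_mul ⟨x, rfl⟩ ⟨y, rfl⟩
  refine trivector_induction (fun x y z => ?_) (fun X Y hX hY => ?_) h
  · simp only [interior_ι_ι_mul, interior_ι_apply_ι, Algebra.algebraMap_eq_smul_one, mul_sub,
      mul_smul_comm, mul_one]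
    exact sub_mem (Submodule.smul_mem _ _ (mem _ _))
      (sub_mem (Submodule.smul_mem _ _ (mem _ _)) (Submodule.smul_mem _ _ (mem _ _)))
  · rw [map_add]; exact add_mem hX hY

end Exterior

/-! ### Grade involution and the signed Leibniz rule. -/

section Involution

variable {K : Type*} [Field K] {M : Type*} [AddCommGroup M] [Module K M]
  {N : Type*} [AddCommGroup N] [Module K N]

theorem wedge_apply (X Y : ExteriorAlgebra K M) : wedge X Y = X * Y := rfl

theorem wedge_mul (X Y : ExteriorAlgebra K M) : wedge (X * Y) = wedge X * wedge Y :=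
  LinearMap.ext fun Z => mul_assoc X Y Z

theorem wedge_one : wedge (1 : ExteriorAlgebra K M) = 1 :=
  LinearMap.ext fun Z => one_mul Z

/-- The grade involution `x₁ ∧ … ∧ xₘ ↦ (-1)ᵐ x₁ ∧ … ∧ xₘ`. -/
noncomputable def gradeInvolution : ExteriorAlgebra K M →ₐ[K] ExteriorAlgebra K M :=
  ExteriorAlgebra.map (-LinearMap.id)

theorem gradeInvolution_ι (x : M) :
    gradeInvolution (ExteriorAlgebra.ι K x) = -ExteriorAlgebra.ι K x := by
  simp [gradeInvolution]

theorem interior_ι_mul (ξ : Module.Dual K M) (X Y : ExteriorAlgebra K M) :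
    interior (ExteriorAlgebra.ι K ξ) (X * Y)
      = interior (ExteriorAlgebra.ι K ξ) X * Y
        + gradeInvolution X * interior (ExteriorAlgebra.ι K ξ) Y := by
  induction X using exteriorAlgebra_left_induction with
  | h1 => simp [interior_ι_one]
  | smul c X h => simp only [map_smul, smul_mul_assoc, h, smul_add]
  | add X X' hX hX' => simp only [map_add, add_mul, hX, hX']; abel
  | mul x X h =>
    simp only [mul_assoc, interior_ι_ι_mul, h, map_mul, gradeInvolution_ι, sub_mul, mul_add,
      smul_mul_assoc, neg_mul]
    abel

theorem interior_ι_map (f : M →ₗ[K] N) (d : Module.Dual K N) (X : ExteriorAlgebra K M) :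
    interior (ExteriorAlgebra.ι K d) (ExteriorAlgebra.map f X)
      = ExteriorAlgebra.map f (interior (ExteriorAlgebra.ι K (d ∘ₗ f)) X) := by
  induction X using exteriorAlgebra_left_induction with
  | h1 => simp [interior_ι_one]
  | smul c X h => simp only [map_smul, h]
  | add X X' hX hX' => simp only [map_add, hX, hX']
  | mul x X h =>
    simp only [map_mul, ExteriorAlgebra.map_apply_ι, interior_ι_ι_mul, h, map_sub, map_smul,
      LinearMap.comp_apply]

/-- Each vector factor of `X` contributes one sign. The vector `y` need not lie in the range of `f`;
below it is a covector crossing the image of `Λ G` in `Λ (G ⊕ G*)`. -/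
theorem ι_mul_map (f : M →ₗ[K] N) (y : N) (X : ExteriorAlgebra K M) :
    ExteriorAlgebra.ι K y * ExteriorAlgebra.map f X
      = ExteriorAlgebra.map f (gradeInvolution X) * ExteriorAlgebra.ι K y := by
  induction X using exteriorAlgebra_left_induction with
  | h1 => simp
  | smul c X h => simp only [map_smul, mul_smul_comm, smul_mul_assoc, h]
  | add X X' hX hX' => simp only [map_add, mul_add, add_mul, hX, hX']
  | mul x X h =>
    simp only [map_mul, gradeInvolution_ι, ExteriorAlgebra.map_apply_ι, map_neg, neg_mul,
      mul_assoc, ← h]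
    rw [← mul_assoc, ι_mul_ι_comm, neg_mul, mul_assoc]

theorem hat_hat (A : ExteriorAlgebra K M) : hat (hat A) = A :=
  CliffordAlgebra.reverse_reverse (Q := (0 : QuadraticForm K M)) A

theorem hat_ι (x : M) : hat (ExteriorAlgebra.ι K x) = ExteriorAlgebra.ι K x :=
  CliffordAlgebra.reverse_ι (Q := (0 : QuadraticForm K M)) x

theorem interior_hat (A : ExteriorAlgebra K (Module.Dual K M)) :
    interior (hat A) = contractHom A := by
  simp [interior, hat_hat]

theorem contractHom_ι_mul (ξ : Module.Dual K M) (A : ExteriorAlgebra K (Module.Dual K M)) :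
    contractHom (ExteriorAlgebra.ι K ξ * A)
      = interior (ExteriorAlgebra.ι K ξ) * contractHom A := by
  rw [map_mul]
  congr 1
  refine LinearMap.ext fun X => ?_
  rw [interior_ι]
  simp [contractHom]

theorem tensorToEnd_tmul (X : ExteriorAlgebra K M) (A : ExteriorAlgebra K (Module.Dual K M)) :
    tensorToEnd (X ⊗ₜ[K] A) = wedge X * contractHom A := by
  simp [tensorToEnd, interior_hat]

end Involution

/-! ### Clifford action on spinors and normal ordering. -/

section Clifford

variable {K : Type*} [Field K] {G : Type*} [AddCommGroup G] [Module K G]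

/-- The Clifford action of `G ⊕ G*` on `Λ G`: vectors act by exterior multiplication,
covectors by contraction. -/
noncomputable def spinor : (G × Module.Dual K G) →ₗ[K] Module.End K (ExteriorAlgebra K G) :=
  LinearMap.coprod (wedge ∘ₗ ExteriorAlgebra.ι K) (interior ∘ₗ ExteriorAlgebra.ι K)

theorem spinor_apply (v : G × Module.Dual K G) (X : ExteriorAlgebra K G) :
    spinor v X = ExteriorAlgebra.ι K v.1 * X + interior (ExteriorAlgebra.ι K v.2) X := rfl

/-- Normal ordering `Λ (G ⊕ G*) → End (Λ G)`, `X ∧ A ↦ (Y ↦ X ∧ i_Â Y)`. -/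
noncomputable def normalOrder :
    ExteriorAlgebra K (G × Module.Dual K G) →ₗ[K] Module.End K (ExteriorAlgebra K G) :=
  tensorToEnd ∘ₗ tensorEquivExterior.symm.toLinearMap

theorem normalOrder_mul (X : ExteriorAlgebra K G) (A : ExteriorAlgebra K (Module.Dual K G)) :
    normalOrder (ExteriorAlgebra.map (LinearMap.inl K G (Module.Dual K G)) X
        * ExteriorAlgebra.map (LinearMap.inr K G (Module.Dual K G)) A)
      = wedge X * contractHom A := by
  rw [← tensorToExterior_tmul, ← tensorToEnd_tmul]
  exact congrArg tensorToEnd (tensorEquivExterior.symm_apply_apply (X ⊗ₜ[K] A))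

/-- `Λ (G ⊕ G*)` is spanned by the products of `Λ G` and `Λ G*`. -/
theorem exteriorAlgebra_prod_induction {N : Type*} [AddCommGroup N] [Module K N]
    {P : ExteriorAlgebra K (G × N) → Prop}
    (mul : ∀ X A, P (ExteriorAlgebra.map (LinearMap.inl K G N) X
        * ExteriorAlgebra.map (LinearMap.inr K G N) A))
    (add : ∀ U V, P U → P V → P (U + V)) (U : ExteriorAlgebra K (G × N)) : P U := by
  obtain ⟨t, rfl⟩ := (tensorToExterior_bijective (K := K) (M := G) (N := N)).2 U
  induction t using TensorProduct.induction_on with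
  | zero => simpa using mul 0 0
  | tmul X A => rw [tensorToExterior_tmul]; exact mul X A
  | add s t hs ht => rw [map_add]; exact add _ _ hs ht

theorem normalOrder_one :
    normalOrder (1 : ExteriorAlgebra K (G × Module.Dual K G)) = 1 := by
  have := normalOrder_mul (1 : ExteriorAlgebra K G) (1 : ExteriorAlgebra K (Module.Dual K G))
  simpa [wedge_one] using this

theorem normalOrder_ι_vector_mul (x : G) (U : ExteriorAlgebra K (G × Module.Dual K G)) :
    normalOrder (ExteriorAlgebra.ι K (x, 0) * U) = spinor (x, 0) * normalOrder U := by
  induction U using exteriorAlgebra_prod_induction with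
  | mul X A =>
    have h : ExteriorAlgebra.ι K ((x, 0) : G × Module.Dual K G)
        = ExteriorAlgebra.map (LinearMap.inl K G _) (ExteriorAlgebra.ι K x) := by simp
    rw [h, ← mul_assoc, ← map_mul, normalOrder_mul, normalOrder_mul, wedge_mul, mul_assoc]
    congr 1
    refine LinearMap.ext fun Y => ?_
    rw [spinor_apply]
    simp [wedge_apply]
  | add U V hU hV => simp only [mul_add, map_add, hU, hV]

theorem interiorDouble_ι (v : G × Module.Dual K G) :
    interiorDouble (ExteriorAlgebra.ι K v) = interior (ExteriorAlgebra.ι K (scalarProduct v)) := by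
  simp [interiorDouble]

/-- In `X ∧ i_Â Y` the contraction by `ξ` must cross `X` to reach its place among the contractions.
The Leibniz rule gives the crossed term, which is the exterior product `ξ ∧ U`, and the term where
`ξ` hits `X`, which is the single Wick contraction. -/
theorem spinor_covector_mul_normalOrder (ξ : Module.Dual K G)
    (U : ExteriorAlgebra K (G × Module.Dual K G)) :
    spinor (0, ξ) * normalOrder U
      = normalOrder (ExteriorAlgebra.ι K (0, ξ) * U)
        + normalOrder (interiorDouble (ExteriorAlgebra.ι K (0, ξ)) U) := by
  induction U using exteriorAlgebra_prod_induction with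
  | mul X A =>
    have h1 : scalarProduct ((0, ξ) : G × Module.Dual K G) ∘ₗ LinearMap.inl K G _ = ξ := by
      ext; simp [scalarProduct]
    have h2 : scalarProduct ((0, ξ) : G × Module.Dual K G) ∘ₗ LinearMap.inr K G _ = 0 := by
      ext; simp [scalarProduct]
    have h : ExteriorAlgebra.ι K ((0, ξ) : G × Module.Dual K G)
        = ExteriorAlgebra.map (LinearMap.inr K G _) (ExteriorAlgebra.ι K ξ) := by simp
    rw [interiorDouble_ι, interior_ι_mul, interior_ι_map, interior_ι_map, h1, h2, map_zero,
      map_zero, LinearMap.zero_apply, map_zero, mul_zero, add_zero, ← mul_assoc, ι_mul_map,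
      mul_assoc, h, ← map_mul, normalOrder_mul, normalOrder_mul, normalOrder_mul,
      contractHom_ι_mul]
    refine LinearMap.ext fun Y => ?_
    simp only [Module.End.mul_apply, wedge_apply, spinor_apply, LinearMap.add_apply, map_zero,
      zero_mul, zero_add, interior_ι_mul]
    abel
  | add U V hU hV =>
    simp only [mul_add, map_add, hU, hV]
    abel

theorem interiorDouble_one :
    interiorDouble (1 : ExteriorAlgebra K (G × Module.Dual K G)) = 1 := by
  simp [interiorDouble, interior_one]

theorem interiorDouble_mul (U V : ExteriorAlgebra K (G × Module.Dual K G)) :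
    interiorDouble (U * V) = interiorDouble V * interiorDouble U := by
  simp [interiorDouble, interior_mul]

theorem interiorDouble_pow (U : ExteriorAlgebra K (G × Module.Dual K G)) (n : ℕ) :
    interiorDouble (U ^ n) = interiorDouble U ^ n := by
  induction n with
  | zero => simp [interiorDouble_one]
  | succ n ih => rw [pow_succ, interiorDouble_mul, ih, ← pow_succ']

end Clifford

/-! ### Truncated exponentials of nilpotent elements. -/

section Exponential

variable {K : Type*} [Field K]

/-- Any product of `card + 1` of the commuting terms repeats a factor. This is what makes truncating
the exponential of `r` at the dimension of `G` harmless. -/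
theorem commute_sum_sq_zero_pow {A : Type*} [Ring A] {ι : Type*} (a : ι → A)
    (hc : ∀ i j, Commute (a i) (a j)) (h : ∀ i, a i ^ 2 = 0) (s : Finset ι) :
    (∑ i ∈ s, a i) ^ (s.card + 1) = 0 := by
  classical
  induction s using Finset.induction_on with
  | empty => simp
  | insert i s hi ih =>
    rw [Finset.sum_insert hi, Finset.card_insert_of_notMem hi]
    exact (Commute.sum_right s a (a i) fun j _ => hc i j).add_pow_eq_zero_of_add_le_succ_of_pow_eq_zero
      (h i) ih (by omega)

/-- The truncated exponential series. -/
noncomputable def expSum {A : Type*} [Ring A] [Algebra K A] (N : ℕ) (R : A) : A :=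
  ∑ n ∈ Finset.range (N + 1), ((n.factorial : K)⁻¹) • R ^ n

theorem pow_mul_of_commutator {A : Type*} [Ring A] {R V J : A}
    (hV : R * V = V * R + J) (hJ : Commute R J) (n : ℕ) :
    R ^ (n + 1) * V = V * R ^ (n + 1) + (n + 1) • (R ^ n * J) := by
  induction n with
  | zero => simp [hV]
  | succ n ih =>
    have h : R ^ (n + 1) * J = R ^ n * J * R := by
      rw [pow_succ, mul_assoc, hJ.eq, mul_assoc]
    rw [pow_succ R (n + 1), mul_assoc, hV, mul_add, ← mul_assoc, ih, add_mul, smul_mul_assoc,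
      ← h, mul_assoc, ← pow_succ, succ_nsmul _ (n + 1)]
    abel

/-- Since `[R, V] = J` commutes with `R`, the operator `[·, V]` differentiates powers of `R`, and
the exponential is its own derivative. -/
theorem expSum_mul_of_commutator [CharZero K] {A : Type*} [Ring A] [Algebra K A] {R V J : A} {N : ℕ}
    (hN : R ^ (N + 1) = 0) (hV : R * V = V * R + J) (hJ : Commute R J) :
    expSum (K := K) N R * V = V * expSum (K := K) N R + expSum (K := K) N R * J := by
  -- The truncated series loses its top term under differentiation. That term is zero: commuting `V`
  -- past `R ^ (N + 1) = 0` gives `(N + 1) R ^ N J = 0`, and `N + 1` is invertible in characteristic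
  -- zero.
  have h0 : R ^ N * J = 0 := by
    have h := pow_mul_of_commutator hV hJ N
    rw [hN, zero_mul, mul_zero, zero_add, ← Nat.cast_smul_eq_nsmul K] at h
    exact (smul_eq_zero.mp h.symm).resolve_left (Nat.cast_ne_zero.mpr N.succ_ne_zero)
  have h1 : expSum (K := K) N R * J
      = ∑ n ∈ Finset.range N, ((n.factorial : K)⁻¹) • (R ^ n * J) := by
    rw [expSum, Finset.sum_mul, Finset.sum_range_succ, smul_mul_assoc, h0, smul_zero, add_zero]
    exact Finset.sum_congr rfl fun n _ => smul_mul_assoc ..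
  rw [h1, expSum, Finset.sum_range_succ', add_mul, mul_add, Finset.sum_mul, Finset.mul_sum,
    pow_zero, smul_mul_assoc, mul_smul_comm, one_mul, mul_one, add_right_comm,
    ← Finset.sum_add_distrib]
  congr 1
  refine Finset.sum_congr rfl fun n _ => ?_
  rw [smul_mul_assoc, pow_mul_of_commutator hV hJ, smul_add, mul_smul_comm,
    ← Nat.cast_smul_eq_nsmul K, smul_smul]
  congr 2
  rw [Nat.factorial_succ, Nat.cast_mul, mul_inv, mul_assoc, mul_comm, mul_assoc,
    mul_inv_cancel₀ (Nat.cast_ne_zero.mpr n.succ_ne_zero), mul_one]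

theorem isUnit_expSum {A : Type*} [Ring A] [Algebra K A] {R : A} {N : ℕ}
    (hN : R ^ (N + 1) = 0) : IsUnit (expSum (K := K) N R) := by
  rw [expSum, Finset.sum_range_succ', Nat.factorial_zero, Nat.cast_one, inv_one, one_smul, pow_zero]
  refine IsNilpotent.isUnit_add_one ?_
  have : ∑ n ∈ Finset.range N, (((n + 1).factorial : K)⁻¹) • R ^ (n + 1)
      = R * ∑ n ∈ Finset.range N, (((n + 1).factorial : K)⁻¹) • R ^ n := by
    rw [Finset.mul_sum]
    exact Finset.sum_congr rfl fun n _ => by rw [mul_smul_comm, ← pow_succ']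
  rw [this]
  exact Commute.isNilpotent_mul_right
    (Commute.sum_right _ _ _ fun n _ => ((Commute.refl R).pow_right n).smul_right _) ⟨_, hN⟩

theorem commute_expSum {A : Type*} [Ring A] [Algebra K A] {R J : A} (N : ℕ) (h : Commute R J) :
    Commute (expSum (K := K) N R) J :=
  Commute.sum_left _ _ _ fun n _ => (h.pow_left n).smul_left _

end Exponential

/-! ### The recursion that characterizes `Q`. -/

section Quantization

variable {K : Type*} [Field K] {G : Type*} [AddCommGroup G] [Module K G]
  {ι : Type*} [Fintype ι] (e : Module.Basis ι K G)

theorem interiorDouble_expR :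
    interiorDouble (expR e)
      = expSum (K := K) (Fintype.card ι) (interiorDouble (rMatrix e)) := by
  simp [expR, expSum, interiorDouble_pow]

theorem interiorDouble_rMatrix_pow : interiorDouble (rMatrix e) ^ (Fintype.card ι + 1) = 0 := by
  rw [← interiorDouble_pow, rMatrix, smul_pow, ← Finset.card_univ, commute_sum_sq_zero_pow,
    smul_zero, map_zero]
  · intro i j
    have mem : ∀ x y : G × Module.Dual K G,
        ExteriorAlgebra.ι K x * ExteriorAlgebra.ι K y ∈ ⋀[K]^2 (G × Module.Dual K G) := by
      intro x y
      rw [ExteriorAlgebra.exteriorPower, pow_two]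
      exact Submodule.mul_mem_mul ⟨x, rfl⟩ ⟨y, rfl⟩
    have h : ∀ x : G × Module.Dual K G, Commute (ExteriorAlgebra.ι K (e i, (0 : Module.Dual K G))
        * ExteriorAlgebra.ι K ((0 : G), e.coord i)) (ExteriorAlgebra.ι K x) :=
      fun x => bivector_mul_ι (mem _ _) x
    exact (h _).mul_right (h _)
  · intro i
    rw [pow_two, mul_assoc, ← mul_assoc (ExteriorAlgebra.ι K ((0 : G), e.coord i)),
      ι_mul_ι_comm ((0 : G), e.coord i), neg_mul, mul_assoc, ExteriorAlgebra.ι_sq_zero]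
    simp

/-- Contraction by a bivector is a second-order operator, so its commutator with `v ∧ ·` is a single
contraction. The ordering `eᵢ ∧ ξⁱ` puts opposite signs on the vector and covector parts of `v`. -/
theorem interiorDouble_rMatrix_commutator (v : G × Module.Dual K G) :
    interiorDouble (rMatrix e) * wedge (ExteriorAlgebra.ι K v)
      = wedge (ExteriorAlgebra.ι K v) * interiorDouble (rMatrix e)
        + interiorDouble (ExteriorAlgebra.ι K ((1 / 2 : K) • (-v.1, v.2))) := by
  -- The right side is what the terms `eᵢ ∧ ξⁱ` produce one by one, so the identity can be checked
  -- summand by summand.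
  have hv : ((-v.1, v.2) : G × Module.Dual K G)
      = ∑ i, (v.2 (e i) • ((0 : G), e.coord i) - e.coord i v.1 • (e i, (0 : Module.Dual K G))) := by
    refine Prod.ext ?_ ?_
    · simp [Prod.fst_sum, e.sum_repr]
    · refine e.ext fun j => ?_
      classical
      simp [Prod.snd_sum]
  refine LinearMap.ext fun X => ?_
  simp only [rMatrix, map_smul, map_sum, hv, LinearMap.add_apply, Module.End.mul_apply,
    wedge_apply, LinearMap.smul_apply, LinearMap.sum_apply, mul_smul_comm, Finset.mul_sum]
  rw [← smul_add, ← Finset.sum_add_distrib]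
  congr 1
  refine Finset.sum_congr rfl fun i _ => ?_
  simp only [interiorDouble, LinearMap.comp_apply, AlgHom.toLinearMap_apply, map_mul,
    ExteriorAlgebra.map_apply_ι, interior_ι_mul_ι_ι_mul, map_sub, map_smul, LinearMap.sub_apply,
    LinearMap.smul_apply, add_sub_assoc]
  congr 2 <;> simp [scalarProduct]

theorem commute_interiorDouble_rMatrix (v : G × Module.Dual K G) :
    Commute (interiorDouble (rMatrix e)) (interiorDouble (ExteriorAlgebra.ι K v)) := by
  have h : ∀ u w : G × Module.Dual K G,
      Commute (interiorDouble (ExteriorAlgebra.ι K u * ExteriorAlgebra.ι K w))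
        (interiorDouble (ExteriorAlgebra.ι K v)) := fun u w => by
    refine LinearMap.ext fun X => ?_
    simp only [interiorDouble_mul, interiorDouble_ι, Module.End.mul_apply]
    rw [interior_ι_comm (scalarProduct u), map_neg, interior_ι_comm (scalarProduct w), neg_neg]
  rw [rMatrix, map_smul, map_sum]
  exact (Commute.sum_left _ _ _ fun i _ => h _ _).smul_left _

theorem qMap_eq_normalOrder (U : ExteriorAlgebra K (G × Module.Dual K G)) :
    qMap e U = normalOrder (interiorDouble (expR e) U) := rfl

theorem qMap_one : qMap e 1 = 1 := by
  have h : interiorDouble (rMatrix e) (1 : ExteriorAlgebra K (G × Module.Dual K G)) = 0 := by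
    simp [rMatrix, interiorDouble_mul, interiorDouble_ι, interior_ι_one]
  rw [qMap_eq_normalOrder, interiorDouble_expR, expSum, LinearMap.sum_apply,
    Finset.sum_eq_single 0]
  · simp [normalOrder_one]
  · intro n _ hn
    obtain ⟨m, rfl⟩ := Nat.exists_eq_succ_of_ne_zero hn
    rw [LinearMap.smul_apply, pow_succ, Module.End.mul_apply, h, map_zero, smul_zero]
  · simp

theorem commute_interiorDouble_expR (v : G × Module.Dual K G) :
    Commute (interiorDouble (expR e)) (interiorDouble (ExteriorAlgebra.ι K v)) := by
  rw [interiorDouble_expR]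
  exact commute_expSum _ (commute_interiorDouble_rMatrix e v)

theorem interiorDouble_expR_ι_mul [CharZero K] (v : G × Module.Dual K G)
    (U : ExteriorAlgebra K (G × Module.Dual K G)) :
    interiorDouble (expR e) (ExteriorAlgebra.ι K v * U)
      = ExteriorAlgebra.ι K v * interiorDouble (expR e) U
        + (1 / 2 : K) • interiorDouble (ExteriorAlgebra.ι K (-v.1, v.2))
            (interiorDouble (expR e) U) := by
  have h := expSum_mul_of_commutator (K := K) (interiorDouble_rMatrix_pow e)
    (interiorDouble_rMatrix_commutator e v) (commute_interiorDouble_rMatrix e _)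
  rw [← interiorDouble_expR, (commute_interiorDouble_expR e _).eq, map_smul, map_smul] at h
  exact LinearMap.congr_fun h U

theorem interiorDouble_ι_interiorDouble_expR (v : G × Module.Dual K G)
    (U : ExteriorAlgebra K (G × Module.Dual K G)) :
    interiorDouble (ExteriorAlgebra.ι K v) (interiorDouble (expR e) U)
      = interiorDouble (expR e) (interiorDouble (ExteriorAlgebra.ι K v) U) :=
  (LinearMap.congr_fun (commute_interiorDouble_expR e v).eq U).symm

/-- For a vector the normal ordering correction is `0` and `exp r` adds `-½`; for a covector the
correction is `-1` and `exp r` adds `+½`. Both come to `-½`, half of the Clifford contraction. -/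
theorem qMap_ι_mul [CharZero K] (v : G × Module.Dual K G)
    (U : ExteriorAlgebra K (G × Module.Dual K G)) :
    qMap e (ExteriorAlgebra.ι K v * U)
      = spinor v * qMap e U - (1 / 2 : K) • qMap e (interiorDouble (ExteriorAlgebra.ι K v) U) := by
  have hx : ∀ x : G, qMap e (ExteriorAlgebra.ι K (x, 0) * U) = spinor (x, 0) * qMap e U
      - (1 / 2 : K) • qMap e (interiorDouble (ExteriorAlgebra.ι K (x, 0)) U) := fun x => by
    have h : ((-x, 0) : G × Module.Dual K G) = -(x, 0) := by simp
    simp only [qMap_eq_normalOrder, interiorDouble_expR_ι_mul, map_add, map_smul,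
      normalOrder_ι_vector_mul, ← interiorDouble_ι_interiorDouble_expR, h, map_neg, smul_neg,
      LinearMap.neg_apply, sub_eq_add_neg]
  have hξ : ∀ ξ : Module.Dual K G, qMap e (ExteriorAlgebra.ι K (0, ξ) * U)
      = spinor (0, ξ) * qMap e U
        - (1 / 2 : K) • qMap e (interiorDouble (ExteriorAlgebra.ι K (0, ξ)) U) := fun ξ => by
    simp only [qMap_eq_normalOrder, interiorDouble_expR_ι_mul, map_add, map_smul,
      spinor_covector_mul_normalOrder, ← interiorDouble_ι_interiorDouble_expR, neg_zero]
    module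
  have hv : v = (v.1, 0) + (0, v.2) := by simp
  rw [hv]
  simp only [map_add, add_mul, LinearMap.add_apply, smul_add, hx, hξ]
  abel

/-- A linear map on `Λ (G ⊕ G*)` killing `1` and compatible with the recursion of `qMap_ι_mul`
vanishes. -/
theorem eq_zero_of_clifford_recursion
    {Z : ExteriorAlgebra K (G × Module.Dual K G) →ₗ[K] Module.End K (ExteriorAlgebra K G)} {c : K}
    (h1 : Z 1 = 0)
    (hmul : ∀ v U, Z (ExteriorAlgebra.ι K v * U)
      = spinor v * Z U - c • Z (interiorDouble (ExteriorAlgebra.ι K v) U)) : Z = 0 := by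
  -- The recursion for `v ∧ U` also involves `i_v U`, which plain induction on `U` does not reach.
  -- The claim is therefore strengthened to all iterated contractions of `U`.
  have key : ∀ U, ∀ B, Z (contractHom B U) = 0 := by
    intro U
    induction U using exteriorAlgebra_left_induction with
    | h1 =>
      intro B
      induction B using exteriorAlgebra_right_induction with
      | h1 => simpa using h1
      | smul c B h => rw [map_smul, LinearMap.smul_apply, map_smul, h, smul_zero]
      | add A B hA hB => rw [map_add, LinearMap.add_apply, map_add, hA, hB, add_zero]
      | mul ξ B h =>
        rw [map_mul contractHom, Module.End.mul_apply, ← interior_hat (ExteriorAlgebra.ι K ξ), hat_ι,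
          interior_ι_one, map_zero, map_zero]
    | smul c U h => intro B; rw [map_smul, map_smul, h, smul_zero]
    | add U V hU hV => intro B; rw [map_add, map_add, hU, hV, add_zero]
    | mul v U h =>
      intro B
      -- The last factor `ξ` of `B` acts first: `i_ξ (v ∧ U) = ξ(v) U - v ∧ i_ξ U`. The second term
      -- has the original shape with `i_ξ U` for `U`, hence the generalization over `U`.
      induction B using exteriorAlgebra_right_induction generalizing U with
      | h1 =>
        have hU : Z U = 0 := by simpa using h 1
        have hv : Z (interiorDouble (ExteriorAlgebra.ι K v) U) = 0 := by
          have := h (ExteriorAlgebra.ι K (scalarProduct v))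
          rwa [← interior_hat, hat_ι, ← interiorDouble_ι] at this
        simp [hmul, hU, hv]
      | smul c B hB => rw [map_smul, LinearMap.smul_apply, map_smul, hB U h, smul_zero]
      | add A B hA hB => rw [map_add, LinearMap.add_apply, map_add, hA U h, hB U h, add_zero]
      | mul ξ B hB =>
        rw [map_mul contractHom, Module.End.mul_apply, ← interior_hat (ExteriorAlgebra.ι K ξ), hat_ι,
          interior_ι_ι_mul, map_sub, map_sub, map_smul, map_smul, h, smul_zero, zero_sub,
          neg_eq_zero]
        refine hB _ fun A => ?_
        have := h (A * ExteriorAlgebra.ι K ξ)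
        rwa [map_mul contractHom, Module.End.mul_apply, ← interior_hat (ExteriorAlgebra.ι K ξ), hat_ι] at this
  refine LinearMap.ext fun U => ?_
  simpa using key U 1

theorem interiorDouble_expR_bijective : Function.Bijective (interiorDouble (expR e)) := by
  rw [← Module.End.isUnit_iff, interiorDouble_expR]
  exact isUnit_expSum (interiorDouble_rMatrix_pow e)

end Quantization

/-! ### Normal ordering is a bijection onto the endomorphisms of `Λ G`. -/

section NormalOrder

variable {K : Type*} [Field K] {G : Type*} [AddCommGroup G] [Module K G]

theorem wedge_ι_mul_tensorToEnd_mem (x : G) {T : Module.End K (ExteriorAlgebra K G)}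
    (hT : T ∈ LinearMap.range (tensorToEnd (K := K) (G := G))) :
    wedge (ExteriorAlgebra.ι K x) * T ∈ LinearMap.range (tensorToEnd (K := K) (G := G)) := by
  obtain ⟨t, rfl⟩ := hT
  induction t using TensorProduct.induction_on with
  | zero => simp
  | tmul X A =>
    refine ⟨(ExteriorAlgebra.ι K x * X) ⊗ₜ A, ?_⟩
    rw [tensorToEnd_tmul, tensorToEnd_tmul, wedge_mul, mul_assoc]
  | add s t hs ht => rw [map_add, mul_add]; exact add_mem hs ht

theorem interior_ι_mul_tensorToEnd_mem (ξ : Module.Dual K G)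
    {T : Module.End K (ExteriorAlgebra K G)}
    (hT : T ∈ LinearMap.range (tensorToEnd (K := K) (G := G))) :
    interior (ExteriorAlgebra.ι K ξ) * T ∈ LinearMap.range (tensorToEnd (K := K) (G := G)) := by
  obtain ⟨t, rfl⟩ := hT
  induction t using TensorProduct.induction_on with
  | zero => simp
  | tmul X A =>
    refine ⟨interior (ExteriorAlgebra.ι K ξ) X ⊗ₜ A
      + gradeInvolution X ⊗ₜ (ExteriorAlgebra.ι K ξ * A), ?_⟩
    rw [map_add, tensorToEnd_tmul, tensorToEnd_tmul, tensorToEnd_tmul, contractHom_ι_mul]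
    refine LinearMap.ext fun Y => ?_
    simp only [LinearMap.add_apply, Module.End.mul_apply, wedge_apply, interior_ι_mul]
  | add s t hs ht => rw [map_add, mul_add]; exact add_mem hs ht

variable {ι : Type*} (e : Module.Basis ι K G)

/-- The product of the projections `i_{ξⁱ} ∘ (eᵢ ∧ ·)` for `i` in the list. -/
noncomputable def projectionAway (l : List ι) : Module.End K (ExteriorAlgebra K G) :=
  (l.map fun i => interior (ExteriorAlgebra.ι K (e.coord i)) * wedge (ExteriorAlgebra.ι K (e i))).prod

theorem projectionAway_cons (j : ι) (l : List ι) (X : ExteriorAlgebra K G) :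
    projectionAway e (j :: l) X = interior (ExteriorAlgebra.ι K (e.coord j))
      (ExteriorAlgebra.ι K (e j) * projectionAway e l X) := by
  simp only [projectionAway, List.map_cons, List.prod_cons, Module.End.mul_apply, wedge_apply]

theorem projectionAway_mem_range (l : List ι) :
    projectionAway e l ∈ LinearMap.range (tensorToEnd (K := K) (G := G)) := by
  induction l with
  | nil => exact ⟨1 ⊗ₜ 1, by simp [tensorToEnd_tmul, wedge_one, projectionAway]⟩
  | cons j l ih =>
    have := interior_ι_mul_tensorToEnd_mem (e.coord j) (wedge_ι_mul_tensorToEnd_mem (e j) ih)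
    rwa [← mul_assoc] at this

theorem projectionAway_one (l : List ι) : projectionAway e l 1 = 1 := by
  induction l with
  | nil => simp [projectionAway]
  | cons j l ih => simp [projectionAway_cons, ih, interior_ι_apply_ι]

theorem projectionAway_ι_mul_of_notMem {i : ι} {l : List ι} (hi : i ∉ l)
    (X : ExteriorAlgebra K G) :
    projectionAway e l (ExteriorAlgebra.ι K (e i) * X)
      = ExteriorAlgebra.ι K (e i) * projectionAway e l X := by
  induction l with
  | nil => simp [projectionAway]
  | cons j l ih =>
    rw [List.mem_cons, not_or] at hi
    rw [projectionAway_cons, projectionAway_cons, ih hi.2, ← mul_assoc, ι_mul_ι_comm, neg_mul,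
      mul_assoc, map_neg, interior_ι_ι_mul]
    simp [Ne.symm hi.1]

theorem projectionAway_interior_of_notMem {i : ι} {l : List ι} (hi : i ∉ l)
    (X : ExteriorAlgebra K G) :
    projectionAway e l (interior (ExteriorAlgebra.ι K (e.coord i)) X)
      = interior (ExteriorAlgebra.ι K (e.coord i)) (projectionAway e l X) := by
  induction l with
  | nil => simp [projectionAway]
  | cons j l ih =>
    rw [List.mem_cons, not_or] at hi
    rw [projectionAway_cons, projectionAway_cons, ih hi.2, interior_ι_comm (e.coord i),
      interior_ι_ι_mul (e.coord i)]
    simp [hi.1]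

theorem projectionAway_ι_mul_of_mem {i : ι} {l : List ι} (hi : i ∈ l)
    (X : ExteriorAlgebra K G) :
    projectionAway e l (ExteriorAlgebra.ι K (e i) * X) = 0 := by
  induction l with
  | nil => simp at hi
  | cons j l ih =>
    by_cases hl : i ∈ l
    · rw [projectionAway_cons, ih hl, mul_zero, map_zero]
    · obtain rfl : i = j := (List.mem_cons.mp hi).resolve_right hl
      rw [projectionAway_cons, projectionAway_ι_mul_of_notMem e hl, ← mul_assoc,
        ExteriorAlgebra.ι_sq_zero, zero_mul, map_zero]

/-- This is `1 = i_{ξʲ} eⱼ + eⱼ i_{ξʲ}` applied after the projection away from `l`: elements free of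
`eⱼ` plus elements divisible by `eⱼ`. -/
theorem projectionAway_eq_cons_add {j : ι} {l : List ι} (hj : j ∉ l) :
    projectionAway e l = projectionAway e (j :: l)
      + wedge (ExteriorAlgebra.ι K (e j)) * projectionAway e (j :: l)
        * interior (ExteriorAlgebra.ι K (e.coord j)) := by
  refine LinearMap.ext fun X => ?_
  simp only [LinearMap.add_apply, Module.End.mul_apply, wedge_apply, projectionAway_cons,
    interior_ι_ι_mul, projectionAway_interior_of_notMem e hj, interior_ι_interior_ι]
  simp

/-- The span of the operators `(X ∧ ·) ∘ P ∘ i_A`. -/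
def sandwichSpan (P : Module.End K (ExteriorAlgebra K G)) :
    Submodule K (Module.End K (ExteriorAlgebra K G)) :=
  Submodule.span K (Set.range fun p : ExteriorAlgebra K G × ExteriorAlgebra K (Module.Dual K G) =>
    wedge p.1 * P * contractHom p.2)

theorem wedge_mul_mul_interior_mem_sandwichSpan {P T : Module.End K (ExteriorAlgebra K G)}
    (hT : T ∈ sandwichSpan P) (x : G) (ξ : Module.Dual K G) :
    wedge (ExteriorAlgebra.ι K x) * T * interior (ExteriorAlgebra.ι K ξ) ∈ sandwichSpan P := by
  induction hT using Submodule.span_induction with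
  | mem T h =>
    obtain ⟨⟨X, A⟩, rfl⟩ := h
    refine Submodule.subset_span ⟨(ExteriorAlgebra.ι K x * X, A * ExteriorAlgebra.ι K ξ), ?_⟩
    simp only [wedge_mul, map_mul, mul_assoc]
    rw [← interior_hat (ExteriorAlgebra.ι K ξ), hat_ι]
  | zero => simp
  | add S T _ _ hS hT => rw [mul_add, add_mul]; exact add_mem hS hT
  | smul c T _ hT => rw [mul_smul_comm, smul_mul_assoc]; exact Submodule.smul_mem _ _ hT

/-- Splitting off one basis direction at a time resolves the identity into pieces `X ∧ P(i_A ·)`, a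
completeness relation around the final projection. -/
theorem one_mem_sandwichSpan {l : List ι} (hl : l.Nodup) :
    (1 : Module.End K (ExteriorAlgebra K G)) ∈ sandwichSpan (projectionAway e l) := by
  -- The list is cut in two so that the full projection stays fixed while the partial one shrinks;
  -- the case `l'' = []` is the identity operator.
  have key : ∀ l' l'' : List ι, (l' ++ l'').Nodup →
      projectionAway e l'' ∈ sandwichSpan (projectionAway e (l' ++ l'')) := by
    intro l'
    induction l' using List.reverseRecOn with
    | nil =>
      intro l'' _
      exact Submodule.subset_span ⟨(1, 1), by simp [wedge_one]⟩
    | append_singleton l' j ih =>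
      intro l'' h
      rw [List.append_assoc, List.singleton_append] at h ⊢
      have hj : j ∉ l'' := (List.nodup_cons.mp (List.nodup_append.mp h).2.1).1
      rw [projectionAway_eq_cons_add e hj]
      exact add_mem (ih _ h) (wedge_mul_mul_interior_mem_sandwichSpan (ih _ h) _ _)
  simpa [projectionAway] using key l [] (by simpa using hl)

/-- With every basis direction listed, anything divisible by a vector is killed and only the scalar
part survives. -/
theorem projectionAway_eq {l : List ι} (hl : ∀ i, i ∈ l) (X : ExteriorAlgebra K G) :
    projectionAway e l X = algebraMap K _ (ExteriorAlgebra.algebraMapInv X) := by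
  induction X using exteriorAlgebra_left_induction with
  | h1 => simp [projectionAway_one]
  | smul c X h => simp only [map_smul, h, Algebra.algebraMap_eq_smul_one, smul_eq_mul, mul_smul]
  | add X Y hX hY => simp only [map_add, hX, hY]
  | mul x X h =>
    have h0 : (projectionAway e l ∘ₗ (LinearMap.mul K (ExteriorAlgebra K G)).flip X)
        ∘ₗ ExteriorAlgebra.ι K = 0 :=
      e.ext fun i => projectionAway_ι_mul_of_mem e (hl i) X
    have h1 : projectionAway e l (ExteriorAlgebra.ι K x * X) = 0 := LinearMap.congr_fun h0 x
    rw [h1, map_mul]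
    simp [ExteriorAlgebra.algebraMapInv]

variable [Fintype ι]

-- The projection `P` onto scalars is normally ordered. Since `T (X ∧ P Y) = (T X) ∧ P Y`, composing
-- an arbitrary `T` with the resolution of the identity around `P` again gives normally ordered
-- operators.
include e in
theorem tensorToEnd_surjective : Function.Surjective (tensorToEnd (K := K) (G := G)) := by
  rw [← LinearMap.range_eq_top, eq_top_iff]
  intro T _
  set P := projectionAway e (Finset.univ : Finset ι).toList with hP
  have hPX := projectionAway_eq e (l := (Finset.univ : Finset ι).toList) (by simp)
  have hw : ∀ X : ExteriorAlgebra K G, ∀ T ∈ LinearMap.range (tensorToEnd (K := K) (G := G)),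
      wedge X * T ∈ LinearMap.range (tensorToEnd (K := K) (G := G)) := by
    intro X T hT
    induction X using exteriorAlgebra_left_induction with
    | h1 => rwa [wedge_one, one_mul]
    | smul c X h => rw [map_smul, smul_mul_assoc]; exact Submodule.smul_mem _ _ h
    | add X Y hX hY => rw [map_add, add_mul]; exact add_mem hX hY
    | mul x X h => rw [wedge_mul, mul_assoc]; exact wedge_ι_mul_tensorToEnd_mem x h
  have hc : ∀ A, ∀ T ∈ LinearMap.range (tensorToEnd (K := K) (G := G)),
      T * contractHom A ∈ LinearMap.range (tensorToEnd (K := K) (G := G)) := by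
    rintro A _ ⟨t, rfl⟩
    induction t using TensorProduct.induction_on with
    | zero => simp
    | tmul X B => exact ⟨X ⊗ₜ (B * A), by simp [tensorToEnd_tmul, mul_assoc]⟩
    | add s t hs ht => rw [map_add, add_mul]; exact add_mem hs ht
  have key : ∀ S ∈ sandwichSpan P, T * S ∈ LinearMap.range (tensorToEnd (K := K) (G := G)) := by
    intro S hS
    induction hS using Submodule.span_induction with
    | mem S h =>
      obtain ⟨⟨X, A⟩, rfl⟩ := h
      have : T * (wedge X * P * contractHom A) = wedge (T X) * P * contractHom A := by
        refine LinearMap.ext fun Y => ?_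
        simp only [Module.End.mul_apply, wedge_apply, hP, hPX, Algebra.algebraMap_eq_smul_one,
          mul_one, map_smul]
      rw [this]
      exact hc _ _ (hw _ _ (projectionAway_mem_range e _))
    | zero => simp
    | add S S' _ _ hS hS' => rw [mul_add]; exact add_mem hS hS'
    | smul c S _ hS => rw [mul_smul_comm]; exact Submodule.smul_mem _ _ hS
  simpa using key 1 (one_mem_sandwichSpan e (Finset.nodup_toList _))

-- Both sides have dimension `2ⁿ · 2ⁿ`, so surjectivity is enough.
include e in
theorem tensorToEnd_bijective : Function.Bijective (tensorToEnd (K := K) (G := G)) := by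
  classical
  let f : G ≃ₗ[K] Module.Dual K G := e.toDualEquiv
  let b : Module.Basis (Finset (Fin (Fintype.card ι))) K (ExteriorAlgebra K G) :=
    (e.reindex (Fintype.equivFin ι)).ExteriorAlgebra
  let b' : Module.Basis (Finset (Fin (Fintype.card ι))) K (ExteriorAlgebra K (Module.Dual K G)) :=
    ((e.reindex (Fintype.equivFin ι)).map f).ExteriorAlgebra
  have := Module.Basis.finiteDimensional_of_finite b
  have := Module.Basis.finiteDimensional_of_finite b'
  have hd : Module.finrank K (ExteriorAlgebra K G ⊗[K] ExteriorAlgebra K (Module.Dual K G))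
      = Module.finrank K (Module.End K (ExteriorAlgebra K G)) := by
    rw [Module.finrank_tensorProduct, Module.finrank_linearMap,
      Module.finrank_eq_card_basis b, Module.finrank_eq_card_basis b']
  exact ⟨(LinearMap.injective_iff_surjective_of_finrank_eq_finrank hd).2
    (tensorToEnd_surjective e), tensorToEnd_surjective e⟩

theorem qMap_bijective : Function.Bijective (qMap e) :=
  (tensorToEnd_bijective e).comp
    (tensorEquivExterior.symm.bijective.comp (interiorDouble_expR_bijective e))

end NormalOrder

end LieQuasi

/-! ### The double acting on spinors, and equivariance of `Q`. -/

namespace LieQuasiBialgebra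

open LieQuasi

variable {K : Type*} [Field K] {G : Type*} [LieRing G] [LieAlgebra K G]

theorem comp_ad (x : G) (ξ : Module.Dual K G) :
    ξ ∘ₗ (LieAlgebra.ad K G x : Module.End K G) = -adStarMu x ξ := by
  simp [adStarMu]

theorem dualBracket_apply (S : LieQuasiBialgebra K G) (ξ η : Module.Dual K G) (x : G) :
    S.dualBracket ξ η x
      = -pairing (ExteriorAlgebra.ι K ξ * ExteriorAlgebra.ι K η) (S.cobracket x) := rfl

theorem interior_ι_interior_ι_phi (S : LieQuasiBialgebra K G) (ξ η : Module.Dual K G) :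
    interior (ExteriorAlgebra.ι K η)
        (interior (ExteriorAlgebra.ι K ξ) (S.phi : ExteriorAlgebra K G))
      = ExteriorAlgebra.ι K (S.phiMap ξ η) := by
  rw [← ι_ιInv_of_mem_range (interior_ι_bivector_mem_range (interior_ι_trivector_mem S.phi.2 ξ) η)]
  simp [phiMap, interior_mul]

theorem apply_phiMap (S : LieQuasiBialgebra K G) (ξ η ζ : Module.Dual K G) :
    ζ (S.phiMap ξ η) = pairing (ExteriorAlgebra.ι K ξ * ExteriorAlgebra.ι K η
      * ExteriorAlgebra.ι K ζ) (S.phi : ExteriorAlgebra K G) := by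
  rw [← pairing_ι_ι, ← interior_ι_interior_ι_phi, pairing_interior, pairing_interior,
    mul_assoc]

theorem dualBracket_swap (S : LieQuasiBialgebra K G) (ξ η : Module.Dual K G) :
    S.dualBracket ξ η = -S.dualBracket η ξ := by
  refine LinearMap.ext fun x => ?_
  rw [LinearMap.neg_apply, dualBracket_apply, dualBracket_apply, ι_mul_ι_comm, map_neg,
    LinearMap.neg_apply]

theorem apply_phiMap_swap (S : LieQuasiBialgebra K G) (ξ η ζ : Module.Dual K G) :
    ζ (S.phiMap ξ η) = -η (S.phiMap ξ ζ) := by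
  rw [apply_phiMap, apply_phiMap, mul_assoc, ι_mul_ι_comm, mul_neg, map_neg, LinearMap.neg_apply,
    mul_assoc]

theorem adStarMu_apply (x y : G) (ξ : Module.Dual K G) : adStarMu x ξ y = -ξ ⁅x, y⁆ := rfl

theorem scalarProduct_apply (u v : G × Module.Dual K G) :
    scalarProduct u v = u.2 v.1 + v.2 u.1 := rfl

theorem phiMap_swap (S : LieQuasiBialgebra K G) (ξ η : Module.Dual K G) :
    S.phiMap ξ η = -S.phiMap η ξ := by
  rw [← add_eq_zero_iff_eq_neg, ← Module.forall_dual_apply_eq_zero_iff K]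
  intro ζ
  rw [map_add, apply_phiMap, apply_phiMap, ι_mul_ι_comm, neg_mul, map_neg, LinearMap.neg_apply,
    neg_add_cancel]

variable [FiniteDimensional K G]

theorem comp_adStarGamma (S : LieQuasiBialgebra K G) (ξ η : Module.Dual K G) :
    η ∘ₗ S.adStarGamma ξ = -S.dualBracket ξ η :=
  LinearMap.ext fun x => S.adStarGamma_apply ξ η x

theorem interior_ι_cobracket (S : LieQuasiBialgebra K G) (ξ : Module.Dual K G) (x : G) :
    interior (ExteriorAlgebra.ι K ξ) (S.cobracket x : ExteriorAlgebra K G)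
      = ExteriorAlgebra.ι K (S.adStarGamma ξ x) := by
  have h := interior_ι_bivector_mem_range (S.cobracket x).2 ξ
  rw [← ι_ιInv_of_mem_range h]
  congr 1
  rw [← sub_eq_zero, ← Module.forall_dual_apply_eq_zero_iff K]
  intro η
  rw [map_sub, apply_ιInv_of_mem_range h, pairing_interior, adStarGamma_apply, dualBracket_apply,
    neg_neg, sub_self]

/-- Contracting either leg of `d_μ ξ` with `y` yields `ad*_y ξ`, by antisymmetry of `μ`; the two
equal contributions absorb the factor `½`. -/
theorem interior_dMu_ι_mul [CharZero K] (ξ : Module.Dual K G) (y : G) (Y : ExteriorAlgebra K G) :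
    interior (dMu ξ) (ExteriorAlgebra.ι K y * Y)
      = ExteriorAlgebra.ι K y * interior (dMu ξ) Y
        + interior (ExteriorAlgebra.ι K (adStarMu y ξ)) Y := by
  have h1 : ∑ i, (Module.finBasis K G).coord i y • adStarMu (Module.finBasis K G i) ξ
      = adStarMu y ξ := by
    conv_rhs => rw [← (Module.finBasis K G).sum_repr y]
    simp only [map_sum, map_smul, LinearMap.sum_apply, LinearMap.smul_apply,
      Module.Basis.coord_apply]
  have h2 : ∑ i, adStarMu (Module.finBasis K G i) ξ y • (Module.finBasis K G).coord i
      = -adStarMu y ξ := by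
    refine (Module.finBasis K G).ext fun j => ?_
    simp [adStarMu, Finsupp.single_apply]
    rw [← lie_skew, map_neg, neg_neg]
  have h3 : interior (ExteriorAlgebra.ι K (adStarMu y ξ)) Y
      = (1 / 2 : K) • (interior (ExteriorAlgebra.ι K
          (∑ i, (Module.finBasis K G).coord i y • adStarMu (Module.finBasis K G i) ξ)) Y
        - interior (ExteriorAlgebra.ι K
          (∑ i, adStarMu (Module.finBasis K G i) ξ y • (Module.finBasis K G).coord i)) Y) := by
    rw [h1, h2, map_neg, map_neg, LinearMap.neg_apply, sub_neg_eq_add, ← two_smul K, smul_smul]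
    norm_num
  rw [h3]
  simp only [dMu, LinearMap.smul_apply, LinearMap.sum_apply, LinearMap.comp_apply, wedge_apply,
    map_smul, map_sum, interior_ι_mul_ι_ι_mul, Finset.mul_sum, mul_smul_comm]
  rw [← smul_add, ← Finset.sum_sub_distrib, ← Finset.sum_add_distrib]
  simp only [add_sub_assoc]

theorem interior_dMu_interior_ι (ξ η : Module.Dual K G) (Y : ExteriorAlgebra K G) :
    interior (dMu ξ) (interior (ExteriorAlgebra.ι K η) Y)
      = interior (ExteriorAlgebra.ι K η) (interior (dMu ξ) Y) := by
  simp only [dMu, LinearMap.smul_apply, LinearMap.sum_apply, LinearMap.comp_apply, wedge_apply,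
    map_smul, map_sum, interior_mul, Module.End.mul_apply]
  congr 1
  refine Finset.sum_congr rfl fun i _ => ?_
  rw [interior_ι_comm _ η, map_neg, interior_ι_comm _ η, neg_neg]

theorem rep_apply (S : LieQuasiBialgebra K G) (v : G × Module.Dual K G)
    (Y : ExteriorAlgebra K G) :
    S.rep v Y = ((S.cobracket v.1 : ExteriorAlgebra K G) * Y
        + deriv (LieAlgebra.ad K G v.1 : Module.End K G) Y
        - (1 / 2 : K) • LinearMap.trace K G (LieAlgebra.ad K G v.1) • Y)
      + (-interior (dMu v.2) Y + deriv (S.adStarGamma v.2) Y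
        - interior (ExteriorAlgebra.ι K v.2) (S.phi : ExteriorAlgebra K G) * Y
        + (1 / 2 : K) • LinearMap.trace K (Module.Dual K G) (S.dualBracket v.2) • Y) := rfl

/-- The operator `ℜ_v` implements `ad_v` on the Clifford generators. -/
theorem rep_commutator_spinor [CharZero K] (S : LieQuasiBialgebra K G)
    (v u : G × Module.Dual K G) :
    S.rep v * spinor u - spinor u * S.rep v = spinor (S.doubleBracket v u) := by
  refine LinearMap.ext fun Y => ?_
  -- The bivectors `γ(x)` and `i_ξ φ` commute with exterior multiplication, so they contribute only
  -- through their commutator with contractions, namely the terms `ad^{γ*}` and `φ(ξ, η)` of the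
  -- bracket.
  have h1 := bivector_mul_ι (S.cobracket v.1).2 u.1
  have h2 := bivector_mul_ι (interior_ι_trivector_mem S.phi.2 v.2) u.1
  simp only [LinearMap.sub_apply, Module.End.mul_apply, spinor_apply, rep_apply, map_add, map_sub,
    map_neg, map_smul, deriv_ι_mul, interior_ι_deriv, interior_dMu_ι_mul, interior_dMu_interior_ι,
    smul_add, comp_ad, comp_adStarGamma,
    interior_ι_bivector_mul (S.cobracket v.1).2,
    interior_ι_bivector_mul (interior_ι_trivector_mem S.phi.2 v.2), interior_ι_cobracket,
    interior_ι_interior_ι_phi, ← mul_assoc, h1, h2, doubleBracket, LinearMap.mk₂_apply,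
    LieAlgebra.ad_apply, LinearMap.add_apply, LinearMap.neg_apply, add_mul, sub_mul]
  abel

theorem doubleBracket_fst (S : LieQuasiBialgebra K G) (u v : G × Module.Dual K G) :
    (S.doubleBracket u v).1
      = ⁅u.1, v.1⁆ - S.adStarGamma v.2 u.1 + S.adStarGamma u.2 v.1 + S.phiMap u.2 v.2 := rfl

theorem doubleBracket_snd (S : LieQuasiBialgebra K G) (u v : G × Module.Dual K G) :
    (S.doubleBracket u v).2
      = adStarMu u.1 v.2 - adStarMu v.1 u.2 + S.dualBracket u.2 v.2 := rfl

theorem doubleBracket_swap (S : LieQuasiBialgebra K G) (u v : G × Module.Dual K G) :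
    S.doubleBracket u v = -S.doubleBracket v u := by
  refine Prod.ext ?_ ?_
  · rw [Prod.fst_neg, doubleBracket_fst, doubleBracket_fst, ← lie_skew u.1, phiMap_swap]
    abel
  · rw [Prod.snd_neg, doubleBracket_snd, doubleBracket_snd, dualBracket_swap]
    abel

/-- The scalar product is invariant under the bracket of the double. -/
theorem scalarProduct_doubleBracket (S : LieQuasiBialgebra K G) (u v w : G × Module.Dual K G) :
    scalarProduct u (S.doubleBracket v w) = -scalarProduct (S.doubleBracket v u) w := by
  simp only [scalarProduct_apply, doubleBracket_fst, doubleBracket_snd, map_add, map_sub,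
    LinearMap.add_apply, LinearMap.sub_apply, adStarGamma_apply, adStarMu_apply]
  rw [apply_phiMap_swap S v.2 w.2, dualBracket_swap S u.2 w.2, ← lie_skew w.1 u.1,
    LinearMap.neg_apply, map_neg]
  ring

/-- `Q` intertwines the adjoint action and the commutator action of the double. -/
theorem qMap_adExterior [CharZero K] (S : LieQuasiBialgebra K G) {ι : Type*} [Fintype ι]
    (e : Module.Basis ι K G) (v : G × Module.Dual K G)
    (U : ExteriorAlgebra K (G × Module.Dual K G)) :
    qMap e (S.adExterior v U) = S.commAction v (qMap e U) := by
  have h : qMap e ∘ₗ S.adExterior v - S.commAction v ∘ₗ qMap e = 0 := by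
    refine eq_zero_of_clifford_recursion (c := 1 / 2) ?_ fun u U => ?_
    · simp [adExterior, LieQuasi.deriv_one, qMap_one, commAction]
    -- Invariance gives `i_u ad_v = ad_v i_u - i_{[v, u]}`. Its last term cancels the `½` correction
    -- coming from `[v, u] ∧ U`, which leaves exactly the recursion for the difference.
    · have hs : scalarProduct u ∘ₗ S.doubleBracket v = -scalarProduct (S.doubleBracket v u) :=
        LinearMap.ext fun w => scalarProduct_doubleBracket S u v w
      have hr : S.rep v * spinor u = spinor u * S.rep v + spinor (S.doubleBracket v u) := by
        rw [← rep_commutator_spinor, add_sub_cancel]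
      simp only [LinearMap.sub_apply, LinearMap.comp_apply, adExterior, commAction,
        LinearMap.mk₂_apply, deriv_ι_mul, map_add, qMap_ι_mul, interiorDouble_ι, interior_ι_deriv,
        hs, map_neg, LinearMap.neg_apply, mul_sub, sub_mul, mul_smul_comm, smul_mul_assoc,
        ← mul_assoc, hr, add_mul, smul_add, smul_sub, smul_neg]
      abel
  exact sub_eq_zero.mp (LinearMap.congr_fun h U)

theorem isLieRepresentation_adExterior (S : LieQuasiBialgebra K G)
    (h : IsLieBracket S.doubleBracket) : IsLieRepresentation S.doubleBracket S.adExterior := by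
  intro u v
  rw [adExterior, LinearMap.comp_apply, LinearMap.comp_apply, LinearMap.comp_apply,
    ← deriv_commutator]
  congr 1
  refine LinearMap.ext fun w => ?_
  have hJ := h.2 u v w
  rw [doubleBracket_swap S w (S.doubleBracket u v), doubleBracket_swap S w u, map_neg,
    add_neg_eq_zero] at hJ
  rw [LinearMap.sub_apply, Module.End.mul_apply, Module.End.mul_apply, ← hJ, sub_eq_add_neg]

/-- The property is transported from `Λ D` along the equivariant surjection `Q`. -/
theorem isLieRepresentation_commAction [CharZero K] (S : LieQuasiBialgebra K G) {ι : Type*}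
    [Fintype ι] (e : Module.Basis ι K G)
    (h : IsLieRepresentation S.doubleBracket S.adExterior) :
    IsLieRepresentation S.doubleBracket S.commAction := by
  intro u v
  refine LinearMap.ext fun T => ?_
  obtain ⟨U, rfl⟩ := (qMap_bijective e).2 T
  simp only [LinearMap.sub_apply, Module.End.mul_apply, ← qMap_adExterior, h u v, map_sub]

end LieQuasiBialgebra

/-! ### Evaluating tensors on covectors, and explicit alternating sums. -/

namespace LieQuasi

section Tensor

variable {K : Type*} [Field K] {M : Type*} [AddCommGroup M] [Module K M]

/-- Evaluation of a tensor on a family of linear forms. -/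
noncomputable def tensorEval {n : ℕ} (ξ : Fin n → Module.Dual K M) : Module.Dual K (⨂[K]^n M) :=
  TensorPower.multilinearMapToDual K M n ξ

theorem tensorEval_tprod {n : ℕ} (ξ : Fin n → Module.Dual K M) (a : Fin n → M) :
    tensorEval ξ (PiTensorProduct.tprod K a) = ∏ i, ξ i (a i) :=
  TensorPower.multilinearMapToDual_apply_tprod ξ a

theorem tensorEval_tensorAction {n : ℕ} (ξ : Fin n → Module.Dual K M) (f : Module.End K M)
    (t : ⨂[K]^n M) :
    tensorEval ξ (tensorAction n f t)
      = ∑ i, tensorEval (Function.update ξ i (ξ i ∘ₗ f)) t := by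
  suffices h : tensorEval ξ ∘ₗ tensorAction n f
      = ∑ i, tensorEval (Function.update ξ i (ξ i ∘ₗ f)) by
    simpa using LinearMap.congr_fun h t
  refine PiTensorProduct.ext (MultilinearMap.ext fun a => ?_)
  simp only [tensorAction, LinearMap.compMultilinearMap_apply, LinearMap.comp_apply,
    LinearMap.sum_apply, map_sum, PiTensorProduct.map_tprod, tensorEval_tprod]
  refine Finset.sum_congr rfl fun i _ => Finset.prod_congr rfl fun j _ => ?_
  by_cases h : j = i
  · subst h; simp
  · simp [h]

theorem tensorEval_reindex {n : ℕ} (ξ : Fin n → Module.Dual K M) (σ : Equiv.Perm (Fin n))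
    (t : ⨂[K]^n M) :
    tensorEval ξ (PiTensorProduct.reindex K (fun _ : Fin n => M) σ t) = tensorEval (ξ ∘ σ) t := by
  suffices h : tensorEval ξ ∘ₗ (PiTensorProduct.reindex K (fun _ : Fin n => M) σ).toLinearMap
      = tensorEval (ξ ∘ σ) from LinearMap.congr_fun h t
  refine PiTensorProduct.ext (MultilinearMap.ext fun a => ?_)
  simp only [LinearMap.compMultilinearMap_apply, LinearMap.comp_apply, LinearEquiv.coe_coe,
    PiTensorProduct.reindex_tprod, tensorEval_tprod]
  exact Fintype.prod_equiv σ.symm _ _ fun i => by simp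

theorem tensorEval_alt {n : ℕ} (ξ : Fin n → Module.Dual K M) (t : ⨂[K]^n M) :
    tensorEval ξ (alt n t)
      = ∑ σ : Equiv.Perm (Fin n), (Equiv.Perm.sign σ : ℤ) • tensorEval (ξ ∘ σ) t := by
  simp only [alt, LinearMap.sum_apply, map_sum]
  refine Finset.sum_congr rfl fun σ _ => ?_
  rw [← tensorEval_reindex, ← map_zsmul]
  rfl

theorem tensorEval_mulEquiv {m n : ℕ} (ξ : Fin m → Module.Dual K M) (η : Fin n → Module.Dual K M)
    (s : ⨂[K]^m M) (t : ⨂[K]^n M) :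
    tensorEval (Fin.append ξ η) (TensorPower.mulEquiv (s ⊗ₜ[K] t))
      = tensorEval ξ s * tensorEval η t := by
  suffices h : ((TensorProduct.mk K _ _).compr₂ (tensorEval (Fin.append ξ η)
      ∘ₗ TensorPower.mulEquiv.toLinearMap))
      = (LinearMap.mul K K).compl₁₂ (tensorEval ξ) (tensorEval η) by
    simpa using LinearMap.congr_fun₂ h s t
  refine PiTensorProduct.ext (MultilinearMap.ext fun a => ?_)
  refine PiTensorProduct.ext (MultilinearMap.ext fun b => ?_)
  have h := TensorPower.tprod_mul_tprod K a b
  rw [TensorPower.gMul_def] at h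
  simp [h, tensorEval_tprod, Fin.prod_univ_add]

theorem tensorEval_applyFirst (γ : M →ₗ[K] ⋀[K]^2 M) {n : ℕ} (ξ : Fin 2 → Module.Dual K M)
    (η : Fin n → Module.Dual K M) (t : ⨂[K]^(1 + n) M) :
    tensorEval (Fin.append ξ η) (applyFirst γ n t)
      = tensorEval (Fin.append ![tensorEval ξ ∘ₗ toTensor 2 ∘ₗ γ] η) t := by
  obtain ⟨s, rfl⟩ := TensorPower.mulEquiv.surjective t
  induction s using TensorProduct.induction_on with
  | zero => simp
  | tmul a b =>
    rw [tensorEval_mulEquiv]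
    simp only [applyFirst, LinearMap.comp_apply, LinearEquiv.coe_coe,
      LinearEquiv.symm_apply_apply, TensorProduct.map_tmul, tensorEval_mulEquiv, LinearMap.id_apply]
    congr 1
    obtain ⟨x, rfl⟩ := (PiTensorProduct.subsingletonEquiv (R := K) (s := fun _ => M)
      (0 : Fin 1)).symm.surjective a
    simp [tensorEval_tprod]
  | add s t hs ht => simp only [map_add, hs, ht]

theorem pairing_ι_mul_ι_mul_ι (ξ η ζ : Module.Dual K M) (x y z : M) :
    pairing (ExteriorAlgebra.ι K ξ * ExteriorAlgebra.ι K η * ExteriorAlgebra.ι K ζ)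
      (ExteriorAlgebra.ι K x * (ExteriorAlgebra.ι K y * ExteriorAlgebra.ι K z))
      = ξ x * (η y * ζ z - η z * ζ y) - ξ y * (η x * ζ z - η z * ζ x)
        + ξ z * (η x * ζ y - η y * ζ x) := by
  rw [mul_assoc, ← pairing_interior]
  simp only [interior_ι_ι_mul, interior_ι_apply_ι, mul_sub, map_sub, map_smul, mul_smul_comm,
    Algebra.algebraMap_eq_smul_one, mul_one, pairing_ι_mul_ι, smul_eq_mul]
  ring

theorem tensorEval_toTensor_ιMulti {n : ℕ} (ξ : Fin n → Module.Dual K M) (a : Fin n → M) :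
    tensorEval ξ (toTensor n (exteriorPower.ιMulti K n a))
      = (Matrix.of fun i j => ξ j (a i)).det := by
  simp [toTensor, tensorEval_tprod, Matrix.det_apply, Units.smul_def, map_sum]

theorem tensorEval_toTensor_two (ξ η : Module.Dual K M) (ω : ⋀[K]^2 M) :
    tensorEval ![ξ, η] (toTensor 2 ω)
      = pairing (ExteriorAlgebra.ι K ξ * ExteriorAlgebra.ι K η) (ω : ExteriorAlgebra K M) := by
  suffices h : tensorEval ![ξ, η] ∘ₗ toTensor 2
      = pairing (ExteriorAlgebra.ι K ξ * ExteriorAlgebra.ι K η) ∘ₗ (⋀[K]^2 M).subtype from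
    LinearMap.congr_fun h ω
  refine exteriorPower.linearMap_ext (AlternatingMap.ext fun a => ?_)
  have ha : (exteriorPower.ιMulti K 2 a : ExteriorAlgebra K M)
      = ExteriorAlgebra.ι K (a 0) * ExteriorAlgebra.ι K (a 1) := by
    rw [exteriorPower.ιMulti_apply_coe, ExteriorAlgebra.ιMulti_apply]
    simp [List.ofFn_succ]
  simp only [LinearMap.compAlternatingMap_apply, LinearMap.comp_apply, tensorEval_toTensor_ιMulti,
    Submodule.subtype_apply, ha, pairing_ι_mul_ι, Matrix.det_fin_two, Matrix.of_apply,
    Matrix.cons_val_zero, Matrix.cons_val_one]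
  ring

theorem tensorEval_toTensor_three (ξ η ζ : Module.Dual K M) (ω : ⋀[K]^3 M) :
    tensorEval ![ξ, η, ζ] (toTensor 3 ω)
      = pairing (ExteriorAlgebra.ι K ξ * ExteriorAlgebra.ι K η * ExteriorAlgebra.ι K ζ)
        (ω : ExteriorAlgebra K M) := by
  suffices h : tensorEval ![ξ, η, ζ] ∘ₗ toTensor 3
      = pairing (ExteriorAlgebra.ι K ξ * ExteriorAlgebra.ι K η * ExteriorAlgebra.ι K ζ)
        ∘ₗ (⋀[K]^3 M).subtype from
    LinearMap.congr_fun h ω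
  refine exteriorPower.linearMap_ext (AlternatingMap.ext fun a => ?_)
  have ha : (exteriorPower.ιMulti K 3 a : ExteriorAlgebra K M) = ExteriorAlgebra.ι K (a 0)
      * (ExteriorAlgebra.ι K (a 1) * ExteriorAlgebra.ι K (a 2)) := by
    rw [exteriorPower.ιMulti_apply_coe, ExteriorAlgebra.ιMulti_apply]
    simp [List.ofFn_succ]
  simp only [LinearMap.compAlternatingMap_apply, LinearMap.comp_apply, tensorEval_toTensor_ιMulti,
    Submodule.subtype_apply, ha, pairing_ι_mul_ι_mul_ι, Matrix.det_fin_three, Matrix.of_apply,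
    Matrix.cons_val_zero, Matrix.cons_val_one, Matrix.cons_val_two, Matrix.head_cons,
    Matrix.tail_cons]
  ring

theorem sum_perm_fin_three (f : Fin 3 → Fin 3 → Fin 3 → K) :
    ∑ σ : Equiv.Perm (Fin 3), (Equiv.Perm.sign σ : ℤ) • f (σ 0) (σ 1) (σ 2)
      = f 0 1 2 - f 0 2 1 + (f 1 2 0 - f 1 0 2) + (f 2 0 1 - f 2 1 0) := by
  -- Indices are put in successor form, the shape matched by the lemmas on
  -- `Equiv.Perm.decomposeFin`.
  have h1 : (1 : Fin 3) = Fin.succ 0 := rfl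
  have h2 : (2 : Fin 3) = Fin.succ 1 := rfl
  simp only [Finset.univ_perm_fin_succ, ← Finset.univ_product_univ, Finset.sum_map,
    Finset.sum_product, Fin.sum_univ_succ, Equiv.toEmbedding_apply, h1, h2,
    Equiv.Perm.decomposeFin_symm_apply_zero, Equiv.Perm.decomposeFin_symm_apply_succ,
    Equiv.Perm.decomposeFin.symm_sign]
  simp [Equiv.swap_apply_def]
  ring

theorem sum_perm_fin_four (f : Fin 4 → Fin 4 → Fin 4 → Fin 4 → K) :
    ∑ σ : Equiv.Perm (Fin 4), (Equiv.Perm.sign σ : ℤ) • f (σ 0) (σ 1) (σ 2) (σ 3)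
      = (f 0 1 2 3 - f 0 1 3 2) + (f 0 2 3 1 - f 0 2 1 3)
        + (f 0 3 1 2 - f 0 3 2 1) + (f 1 0 3 2 - f 1 0 2 3)
        + (f 1 2 0 3 - f 1 2 3 0) + (f 1 3 2 0 - f 1 3 0 2)
        + (f 2 0 1 3 - f 2 0 3 1) + (f 2 1 3 0 - f 2 1 0 3)
        + (f 2 3 0 1 - f 2 3 1 0) + (f 3 0 2 1 - f 3 0 1 2)
        + (f 3 1 0 2 - f 3 1 2 0) + (f 3 2 1 0 - f 3 2 0 1) := by
  have h1 : (1 : Fin 4) = Fin.succ 0 := rfl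
  have h2 : (2 : Fin 4) = Fin.succ 1 := rfl
  have h3 : (3 : Fin 4) = Fin.succ 2 := rfl
  have h4 : (1 : Fin 3) = Fin.succ 0 := rfl
  have h5 : (2 : Fin 3) = Fin.succ 1 := rfl
  simp only [Finset.univ_perm_fin_succ, ← Finset.univ_product_univ, Finset.sum_map,
    Finset.sum_product, Fin.sum_univ_succ, Equiv.toEmbedding_apply, h1, h2, h3, h4, h5,
    Equiv.Perm.decomposeFin_symm_apply_zero, Equiv.Perm.decomposeFin_symm_apply_succ,
    Equiv.Perm.decomposeFin.symm_sign]
  simp [Equiv.swap_apply_def]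
  ring

end Tensor

end LieQuasi

/-! ### The structure identities in scalar form, and the Jacobi identity of the double. -/

namespace LieQuasiBialgebra

open LieQuasi

variable {K : Type*} [Field K] {G : Type*} [LieRing G] [LieAlgebra K G]

theorem tensorEval_comp_cobracket (S : LieQuasiBialgebra K G) (ξ η : Module.Dual K G) :
    tensorEval ![ξ, η] ∘ₗ toTensor 2 ∘ₗ S.cobracket = -S.dualBracket ξ η := by
  refine LinearMap.ext fun x => ?_
  rw [LinearMap.neg_apply, dualBracket_apply, neg_neg, ← tensorEval_toTensor_two]
  rfl

theorem tensorEval_cobracket (S : LieQuasiBialgebra K G) (ξ η : Module.Dual K G) (x : G) :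
    tensorEval ![ξ, η] (toTensor 2 (S.cobracket x)) = -S.dualBracket ξ η x :=
  LinearMap.congr_fun (S.tensorEval_comp_cobracket ξ η) x

theorem tensorEval_phi (S : LieQuasiBialgebra K G) (ξ η ζ : Module.Dual K G) :
    tensorEval ![ξ, η, ζ] (toTensor 3 S.phi) = ζ (S.phiMap ξ η) := by
  rw [tensorEval_toTensor_three, apply_phiMap]

theorem dualBracket_lie (S : LieQuasiBialgebra K G) (ξ η : Module.Dual K G) (x y : G) :
    S.dualBracket ξ η ⁅x, y⁆
      = S.dualBracket (adStarMu y ξ) η x + S.dualBracket ξ (adStarMu y η) x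
        - S.dualBracket (adStarMu x ξ) η y - S.dualBracket ξ (adStarMu x η) y := by
  have h := congrArg (tensorEval ![ξ, η]) (S.cocycle x y)
  have u0 : ∀ ζ : Module.Dual K G, Function.update ![ξ, η] 0 ζ = ![ζ, η] := fun ζ => by
    ext i : 1; fin_cases i <;> simp
  have u1 : ∀ ζ : Module.Dual K G, Function.update ![ξ, η] 1 ζ = ![ξ, ζ] := fun ζ => by
    ext i : 1; fin_cases i <;> simp
  simp only [map_sub, tensorEval_tensorAction, Fin.sum_univ_two, u0, u1, Matrix.cons_val_zero,
    Matrix.cons_val_one, comp_ad, tensorEval_cobracket, map_neg, LinearMap.neg_apply] at h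
  linear_combination -h

theorem apply_phiMap_cyclic (S : LieQuasiBialgebra K G) (ξ η ζ : Module.Dual K G) :
    ζ (S.phiMap ξ η) = ξ (S.phiMap η ζ) := by
  rw [phiMap_swap, map_neg, apply_phiMap_swap, neg_neg]

theorem dualBracket_jacobi [CharZero K] (S : LieQuasiBialgebra K G) (ξ η ζ : Module.Dual K G)
    (x : G) :
    S.dualBracket (S.dualBracket ξ η) ζ x + S.dualBracket (S.dualBracket η ζ) ξ x
        + S.dualBracket (S.dualBracket ζ ξ) η x
      = adStarMu x ξ (S.phiMap η ζ) + adStarMu x η (S.phiMap ζ ξ) + adStarMu x ζ (S.phiMap ξ η) := by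
  -- Packing the covectors into one family turns permutation of the arguments into composition with
  -- `σ`.
  obtain ⟨a, rfl, rfl, rfl⟩ : ∃ a : Fin 3 → Module.Dual K G, ξ = a 0 ∧ η = a 1 ∧ ζ = a 2 :=
    ⟨![ξ, η, ζ], rfl, rfl, rfl⟩
  have h := congrArg (tensorEval a) (S.quasi_coJacobi x)
  have ha : ∀ b : Fin 3 → Module.Dual K G, tensorEval b (toTensor 3 S.phi)
      = b 2 (S.phiMap (b 0) (b 1)) := fun b => by
    rw [← tensorEval_phi]
    congr 2
    ext i : 1; fin_cases i <;> rfl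
  have happ : ∀ σ : Equiv.Perm (Fin 3), tensorEval (a ∘ σ)
      (applyFirst S.cobracket 1 (toTensor 2 (S.cobracket x)))
        = S.dualBracket (S.dualBracket (a (σ 0)) (a (σ 1))) (a (σ 2)) x := by
    intro σ
    have h1 : (a ∘ σ : Fin 3 → Module.Dual K G)
        = Fin.append ![a (σ 0), a (σ 1)] ![a (σ 2)] := by
      ext i : 1; fin_cases i <;> rfl
    have h2 : ∀ a b : Module.Dual K G, Fin.append ![a] ![b] = ![a, b] := fun a b => by
      ext i : 1; fin_cases i <;> rfl
    rw [h1, tensorEval_applyFirst, h2, tensorEval_comp_cobracket, tensorEval_cobracket, map_neg,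
      LinearMap.neg_apply, LinearMap.neg_apply, neg_neg]
  rw [map_smul, tensorEval_alt, Finset.sum_congr rfl fun σ _ => by rw [happ σ],
    sum_perm_fin_three fun i j k => S.dualBracket (S.dualBracket (a i) (a j)) (a k) x] at h
  simp only [map_neg, tensorEval_tensorAction, Fin.sum_univ_three, comp_ad, ha, smul_eq_mul,
    Function.update_self, Function.update_of_ne, ne_eq, Fin.reduceEq, not_false_eq_true,
    LinearMap.neg_apply] at h
  -- The six terms of `Alt` pair up by antisymmetry of the inner bracket, and the resulting factor
  -- `2` cancels the `½`.
  rw [dualBracket_swap S (a 2) (a 1), dualBracket_swap S (a 1) (a 0),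
    dualBracket_swap S (a 0) (a 2), apply_phiMap_cyclic S (adStarMu x (a 0)),
    ← apply_phiMap_cyclic S (a 2)] at h
  simp only [map_neg, LinearMap.neg_apply] at h
  linear_combination h

theorem dualBracket_phiMap [CharZero K] (S : LieQuasiBialgebra K G)
    (ξ₀ ξ₁ ξ₂ ξ₃ : Module.Dual K G) :
    S.dualBracket ξ₀ ξ₁ (S.phiMap ξ₂ ξ₃) - S.dualBracket ξ₀ ξ₂ (S.phiMap ξ₁ ξ₃)
      + S.dualBracket ξ₀ ξ₃ (S.phiMap ξ₁ ξ₂) + S.dualBracket ξ₁ ξ₂ (S.phiMap ξ₀ ξ₃)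
      - S.dualBracket ξ₁ ξ₃ (S.phiMap ξ₀ ξ₂) + S.dualBracket ξ₂ ξ₃ (S.phiMap ξ₀ ξ₁) = 0 := by
  obtain ⟨a, rfl, rfl, rfl, rfl⟩ : ∃ a : Fin 4 → Module.Dual K G,
      ξ₀ = a 0 ∧ ξ₁ = a 1 ∧ ξ₂ = a 2 ∧ ξ₃ = a 3 :=
    ⟨![ξ₀, ξ₁, ξ₂, ξ₃], rfl, rfl, rfl, rfl⟩
  have h := congrArg (tensorEval a) S.alt_phi
  have happ : ∀ σ : Equiv.Perm (Fin 4), tensorEval (a ∘ σ)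
      (applyFirst S.cobracket 2 (toTensor 3 S.phi))
        = -S.dualBracket (a (σ 0)) (a (σ 1)) (S.phiMap (a (σ 2)) (a (σ 3))) := by
    intro σ
    have h1 : (a ∘ σ : Fin 4 → Module.Dual K G)
        = Fin.append ![a (σ 0), a (σ 1)] ![a (σ 2), a (σ 3)] := by
      ext i : 1; fin_cases i <;> rfl
    have h2 : ∀ a b c : Module.Dual K G, Fin.append ![a] ![b, c] = ![a, b, c] := fun a b c => by
      ext i : 1; fin_cases i <;> rfl
    rw [h1, tensorEval_applyFirst, h2, tensorEval_comp_cobracket, tensorEval_phi,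
      apply_phiMap_cyclic, LinearMap.neg_apply]
  rw [tensorEval_alt, Finset.sum_congr rfl fun σ _ => by rw [happ σ],
    sum_perm_fin_four fun i j k l => -S.dualBracket (a i) (a j) (S.phiMap (a k) (a l)),
    map_zero] at h
  rw [dualBracket_swap S (a 1) (a 0), dualBracket_swap S (a 2) (a 0),
    dualBracket_swap S (a 3) (a 0), dualBracket_swap S (a 2) (a 1), dualBracket_swap S (a 3) (a 1),
    dualBracket_swap S (a 3) (a 2), phiMap_swap S (a 1) (a 0), phiMap_swap S (a 2) (a 0),
    phiMap_swap S (a 3) (a 0), phiMap_swap S (a 2) (a 1), phiMap_swap S (a 3) (a 1),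
    phiMap_swap S (a 3) (a 2)] at h
  simp only [map_neg, LinearMap.neg_apply] at h
  -- The 24 permutations give six terms, each four times by antisymmetry in the first and last
  -- pairs; the minus sign comes from `γ(ξ, η)` being the opposite of the transposed cobracket.
  linear_combination (-1 / 4 : K) * h

variable [FiniteDimensional K G]

/-- By multilinearity the identity separates by which arguments are vectors and which covectors.
Four vectors give zero since `G` is an isotropic subalgebra; the other cases are the Lie
quasi-bialgebra axioms and the Jacobi identity of `μ`. -/
theorem scalarProduct_doubleBracket_cyclic [CharZero K] (S : LieQuasiBialgebra K G)
    (u v w z : G × Module.Dual K G) :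
    scalarProduct (S.doubleBracket u v) (S.doubleBracket w z)
      + scalarProduct (S.doubleBracket v w) (S.doubleBracket u z)
      + scalarProduct (S.doubleBracket w u) (S.doubleBracket v z) = 0 := by
  obtain ⟨x₀, ξ₀⟩ := u
  obtain ⟨x₁, ξ₁⟩ := v
  obtain ⟨x₂, ξ₂⟩ := w
  obtain ⟨x₃, ξ₃⟩ := z
  have hB : ∀ (x y : G) (ξ η : Module.Dual K G),
      S.dualBracket η (adStarMu x ξ) y = -S.dualBracket (adStarMu x ξ) η y := fun x y ξ η => by
    rw [dualBracket_swap, LinearMap.neg_apply]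
  have hBB : ∀ (x : G) (ξ η ζ : Module.Dual K G), S.dualBracket ζ (S.dualBracket ξ η) x
      = -S.dualBracket (S.dualBracket ξ η) ζ x := fun x ξ η ζ => by
    rw [dualBracket_swap, LinearMap.neg_apply]
  have hL : ∀ (ξ : Module.Dual K G) (x y z : G),
      ξ ⁅x, ⁅y, z⁆⁆ = ξ ⁅⁅x, y⁆, z⁆ + ξ ⁅y, ⁅x, z⁆⁆ := fun ξ x y z => by
    rw [leibniz_lie, map_add]
  have hL' : ∀ (ξ : Module.Dual K G) (x y z : G), ξ ⁅⁅x, y⁆, z⁆ = -ξ ⁅z, ⁅x, y⁆⁆ :=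
    fun ξ x y z => by rw [← lie_skew, map_neg]
  have J0 := S.dualBracket_jacobi ξ₁ ξ₂ ξ₃ x₀
  have J1 := S.dualBracket_jacobi ξ₀ ξ₂ ξ₃ x₁
  have J2 := S.dualBracket_jacobi ξ₀ ξ₁ ξ₃ x₂
  have J3 := S.dualBracket_jacobi ξ₀ ξ₁ ξ₂ x₃
  have JP := S.dualBracket_phiMap ξ₀ ξ₁ ξ₂ ξ₃
  have L0 := hL ξ₀ x₁ x₂ x₃
  have L1 := hL ξ₁ x₀ x₂ x₃
  have L2 := hL ξ₂ x₀ x₁ x₃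
  have L3 := hL ξ₃ x₀ x₁ x₂
  simp only [hL', dualBracket_swap S ξ₂ ξ₀, dualBracket_swap S ξ₃ ξ₀, dualBracket_swap S ξ₃ ξ₁,
    phiMap_swap S ξ₂ ξ₀, phiMap_swap S ξ₃ ξ₀, phiMap_swap S ξ₃ ξ₁, map_neg, LinearMap.neg_apply]
    at J0 J1 J2 J3 L0 L1 L2 L3
  -- Rewriting with `dualBracket_lie` here disposes of the components with two vectors and two
  -- covectors.
  simp only [scalarProduct_apply, doubleBracket_fst, doubleBracket_snd, map_add, map_sub,
    LinearMap.add_apply, LinearMap.sub_apply, adStarGamma_apply, dualBracket_lie, hB, hBB]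
  simp only [dualBracket_swap S ξ₂ ξ₀, phiMap_swap S ξ₂ ξ₀, ← lie_skew x₂ x₀,
    map_neg, LinearMap.neg_apply]
  simp only [adStarMu_apply] at *
  -- `Ji` handles a vector in slot `i` among covectors, `Li` a covector in slot `i` among vectors,
  -- and `JP` four covectors; the signs alternate with the slot.
  linear_combination -J0 + J1 - J2 + J3 + JP + L0 - L1 + L2 - L3

theorem isLieBracket_doubleBracket [CharZero K] (S : LieQuasiBialgebra K G) :
    IsLieBracket S.doubleBracket := by
  refine ⟨fun u => ?_, fun u v w => ?_⟩
  · have h := S.doubleBracket_swap u u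
    rwa [eq_neg_iff_add_eq_zero, ← two_smul K, smul_eq_zero, or_iff_right two_ne_zero] at h
  -- Invariance moves the outer bracket onto `z`, and nondegeneracy of the scalar product then
  -- removes `z`.
  have h : ∀ z, scalarProduct (S.doubleBracket u (S.doubleBracket v w)
      + S.doubleBracket v (S.doubleBracket w u) + S.doubleBracket w (S.doubleBracket u v)) z = 0 := by
    intro z
    have h := S.scalarProduct_doubleBracket_cyclic u v w z
    simp only [scalarProduct_doubleBracket] at h
    simp only [map_add, LinearMap.add_apply]
    linear_combination -h
  refine Prod.ext ?_ (LinearMap.ext fun x => ?_)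
  · rw [Prod.fst_zero, ← Module.forall_dual_apply_eq_zero_iff K]
    intro τ
    simpa [scalarProduct_apply] using h (0, τ)
  · simpa [scalarProduct_apply] using h (x, 0)

end LieQuasiBialgebra

theorem mainTheorem2 {K : Type*} [RCLike K] {G : Type*} [LieRing G] [LieAlgebra K G]
    [FiniteDimensional K G] (S : LieQuasiBialgebra K G)
    {ι : Type*} [Fintype ι] (e : Module.Basis ι K G) :
    LieQuasi.IsLieBracket S.doubleBracket ∧
    LieQuasi.IsLieRepresentation S.doubleBracket S.adExterior ∧
    LieQuasi.IsLieRepresentation S.doubleBracket S.commAction ∧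
    Function.Bijective (LieQuasi.qMap e) ∧
    ∀ (v : G × Module.Dual K G) (U : ExteriorAlgebra K (G × Module.Dual K G)),
      LieQuasi.qMap e (S.adExterior v U) = S.commAction v (LieQuasi.qMap e U) := by
  have hL := S.isLieBracket_doubleBracket
  have hA := S.isLieRepresentation_adExterior hL
  exact ⟨hL, hA, S.isLieRepresentation_commAction e hA, LieQuasi.qMap_bijective e,
    S.qMap_adExterior e⟩
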